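/- **Setting.** Let $N_n,M_n$ ($n=1,\dots,4$), $M_5,K_5,L_5$ be sizes with $L_5+K_5=M_5+1$, $T_n\in\mathbb C^{M_n\times N_n}$ with $T_n^{\mathrm H}=[t_{n,1},\dots,t_{n,M_n}]$ for $n\le 4$, and $T_5=I_{M_5}$. Let $J_{n,1}=[I,0]$, $J_{n,2}=[0,I]$ be the matrices that drop the last, resp. first, of $M_n$ entries; assume $J_{n,1}T_n=J_{n,2}T_nF_n$ with $F_n$ non-singular, and $Q_nt_{n,M_n}=0$, $Q_nF_n^{\mathrm H}t_{n,1}=0$ ($n\le4$). There are $L$ paths; path $l$ has AOD azimuth/elevation $\phi^l_{\rm az},\phi^l_{\rm el}$, AOA azimuth/elevation $\theta^l_{\rm az},\theta^l_{\rm el}$, delay $\tau_l$ and complex gain $\gamma_l\neq0$. Its angular frequencies are $\omega_{l,1}=\pi\sin\phi^l_{\rm az}\sin\phi^l_{\rm el}$, $\omega_{l,2}=\pi\cos\phi^l_{\rm el}$, $\omega_{l,3}=\pi\sin\theta^l_{\rm az}\sin\theta^l_{\rm el}$, $\omega_{l,4}=\pi\cos\theta^l_{\rm el}$, $\omega_{l,5}=-2\pi\Delta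 f\,\tau_l$ ($\Delta f>0$); put $\Phi_{l,n}=e^{j\omega_{l,n}}$. The angles and the delay lie in an open domain $D\subset\mathbb R^5$ on which $(\phi_{\rm az},\phi_{\rm el},\theta_{\rm az},\theta_{\rm el},\tau)\mapsto(e^{j\omega_1},\dots,e^{j\omega_5})$ is one-to-one, and the cosines of the azimuths and the sines of the elevations of the paths are non-zero. Let $A_n^{(m)}\in\mathbb C^{m\times L}$ have the columns $[1,e^{j\omega_{l,n}},\dots,e^{j(m-1)\omega_{l,n}}]^{\mathrm T}$, and put $B_n=T_n^{\mathrm H}A_n^{(M_n)}$, $B=B_1\odot\cdots\odot B_5$, $P=B_1\odot\cdots\odot B_4\odot A_5^{(K_5)}$, $G=A_5^{(L_5)}$ ($\odot$ is the Khatri–Rao product, $\dagger$ the Moore–Penrose inverse, $\mathrm{Diag}(\gamma)$ the diagonal matrix of $\gamma=(\gamma_1,\dots,\gamma_L)^{\mathrm T}$). The noiseless beamspace channel is $h=B\gamma$. **Algorithm.** On input $\tilde h$: form the smoothed matrix $\tilde H=\mathcal S(\tilde h)\in\mathbb C^{N_1N_2N_3N_4K_5\times L_5}$ with entries $\tilde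 H_{(n_1,\dots,n_4,k),\ell}=\tilde h_{n_1,\dots,n_4,k+\ell-1}$; let $\tilde U_s$ consist of $L$ leading left singular vectors of $\tilde H$; put $\tilde\Gamma_n=(\breve J_{n,1}\tilde U_s)^\dagger\breve J_{n,2}\tilde U_s$, where for $n\le4$ the matrix $\breve J_{n,1}$, resp. $\breve J_{n,2}$, is the Kronecker product of identity matrices with $Q_n$, resp. $Q_nF_n^{\mathrm H}$, in mode $n$, and $\breve J_{5,1}=I\otimes[I_{K_5-1},0]$, $\breve J_{5,2}=I\otimes[0,I_{K_5-1}]$; diagonalize $\sum_n\beta_n\tilde\Gamma_n$ by $\tilde E$; put $\hat\omega_{l,n}=\Im\ln(\tilde E^{-1}\tilde\Gamma_n\tilde E)_{l,l}$; let the estimated angles and delay be the point of $D$ with the angular frequencies $\hat\omega_{l,n}$ (modulo $2\pi$), and let $\hat\gamma=\hat B^\dagger\tilde h$ with $\hat B$ built as $B$ from $\hat\omega$. Assume that the matrices $\breve J_{n,1}P$ ($n=1,\dots,5$) and $G$ have full column rank $L$, and that the numbers $\sum_n\beta_n\Phi_{l,n}$, $l=1,\dots,L$, are distinct. The first-order perturbation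 of the estimates at an error $\Delta h$ is $\delta(\Delta h)$, where $\delta$ is a real-linear map such that for $d\to0$ the algorithm has an output on $h+d$ and every such output is, after relabelling the paths, the vector of true parameters plus $\delta(d)+o(\|d\|)$. **Closed forms.** Let $b_l$ be the $l$-th unit vector, $\lambda_{l,n}^{\mathrm H}=b_l^{\mathrm T}(\breve J_{n,1}P)^\dagger(\breve J_{n,2}-\Phi_{l,n}\breve J_{n,1})$, $\chi_l^*=(G^{\mathrm T})^\dagger b_l$, let $\xi_{l,n}$ be the blockwise (for each $(n_1,\dots,n_4)$) convolution of $\lambda_{l,n}$ and $\chi_l$, $\upsilon_{l,n}=\Phi_{l,n}\xi_{l,n}/\gamma_l^*$, $V_n=[\upsilon_{1,n},\dots,\upsilon_{L,n}]$, and $$\kappa_{l,1}=\frac{\upsilon_{l,1}}{\pi\cos\phi^l_{\rm az}\sin\phi^l_{\rm el}}+\frac{\sin\phi^l_{\rm az}\cos\phi^l_{\rm el}\,\upsilon_{l,2}}{\pi\cos\phi^l_{\rm az}\sin^2\phi^l_{\rm el}},\quad \kappa_{l,2}=\frac{\upsilon_{l,2}}{\pi\sin\phi^l_{\rm el}},$$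 $$\kappa_{l,3}=\frac{\upsilon_{l,3}}{\pi\cos\theta^l_{\rm az}\sin\theta^l_{\rm el}}+\frac{\sin\theta^l_{\rm az}\cos\theta^l_{\rm el}\,\upsilon_{l,4}}{\pi\cos\theta^l_{\rm az}\sin^2\theta^l_{\rm el}},\quad \kappa_{l,4}=\frac{\upsilon_{l,4}}{\pi\sin\theta^l_{\rm el}},\quad \kappa_{l,5}=\frac{\upsilon_{l,5}}{2\pi\Delta f}.$$ Let $\breve B_n$ be $B$ with the factor $B_n$ replaced by $\breve T_n^{\mathrm H}A_n^{(M_n)}$, $\breve T_n=-j\,\mathrm{Diag}(0,\dots,M_n-1)T_n$, let $\Upsilon_n=B^\dagger\breve B_n\mathrm{Diag}(\gamma)$, and $$\Pi_l=\begin{bmatrix}\Re\{b_l^{\mathrm T}B^\dagger\}&-\Im\{b_l^{\mathrm T}B^\dagger\}\\ \Im\{b_l^{\mathrm T}B^\dagger\}&\Re\{b_l^{\mathrm T}B^\dagger\}\end{bmatrix}-\sum_{n=1}^5\begin{bmatrix}\Re\{b_l^{\mathrm T}\Upsilon_n\}\\ \Im\{b_l^{\mathrm T}\Upsilon_n\}\end{bmatrix}\begin{bmatrix}\Im\{V_n^{\mathrm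 H}\}&\Re\{V_n^{\mathrm H}\}\end{bmatrix}.$$ **Claim.** Let the entries of $\Delta h$ be i.i.d. zero-mean circular complex Gaussian of variance $N_0/(N_{\rm p}E_{\rm s})$. Then the first-order perturbation of the channel parameter estimates exists, and for every path $l$ the perturbations $\Delta\phi^l_{\rm az},\Delta\phi^l_{\rm el},\Delta\theta^l_{\rm az},\Delta\theta^l_{\rm el},\Delta\tau_l$ have mean $0$ and mean-square values $\dfrac{N_0\|\kappa_{l,i}\|^2}{2N_{\rm p}E_{\rm s}}$, $i=1,\dots,5$ in this order, and $\mathrm E(\Delta\gamma_l)=0$, $\mathrm E(|\Delta\gamma_l|^2)=\dfrac{N_0\|\Pi_l\|_{\mathrm F}^2}{2N_{\rm p}E_{\rm s}}$. -/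

import Mathlib

open MeasureTheory ProbabilityTheory
open scoped Matrix

noncomputable section

namespace BeamspaceESPRIT

/-! ### Linear algebra -/

/-- The four Penrose equations: `X` is the Moore-Penrose pseudoinverse of `A`. -/
structure IsMoorePenrose {m n : Type*} [Fintype m] [Fintype n]
    (A : Matrix m n ℂ) (X : Matrix n m ℂ) : Prop where
  mul_mul_self : A * X * A = A
  self_mul_mul : X * A * X = X
  left_herm : (A * X)ᴴ = A * X
  right_herm : (X * A)ᴴ = X * A

/-- The Moore-Penrose pseudoinverse (the matrix that satisfies the Penrose equations). -/
def pinv {m n : Type*} [Fintype m] [Fintype n] (A : Matrix m n ℂ) : Matrix n m ℂ :=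
  Classical.epsilon (IsMoorePenrose A)

/-- The columns of `Us` are `L` leading left singular vectors of `H`: there is a singular value
decomposition `H = Us Σs Vsᴴ + Un Σn Vnᴴ` in which every singular value in `Σs` is at least as
large as every singular value in `Σn`. -/
def IsLeadingLeftSingular {m n : Type*} [Fintype m] [Fintype n] {L : ℕ}
    (H : Matrix m n ℂ) (Us : Matrix m (Fin L) ℂ) : Prop :=
  ∃ (k : ℕ) (s : Fin L → ℝ) (Vs : Matrix n (Fin L) ℂ)
    (Un : Matrix m (Fin k) ℂ) (t : Fin k → ℝ) (Vn : Matrix n (Fin k) ℂ),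
    (Matrix.fromCols Us Un)ᴴ * Matrix.fromCols Us Un = 1 ∧
    (Matrix.fromCols Vs Vn)ᴴ * Matrix.fromCols Vs Vn = 1 ∧
    (∀ i, 0 ≤ s i) ∧ (∀ j, 0 ≤ t j) ∧ (∀ i j, t j ≤ s i) ∧
    H = Us * Matrix.diagonal (fun i => (s i : ℂ)) * Vsᴴ
      + Un * Matrix.diagonal (fun j => (t j : ℂ)) * Vnᴴ

/-- The selection matrix `[I_{m-1}, 0]`. -/
def selFirst (m : ℕ) : Matrix (Fin (m - 1)) (Fin m) ℂ :=
  Matrix.of fun i j => if (j : ℕ) = i then 1 else 0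

/-- The selection matrix `[0, I_{m-1}]`. -/
def selLast (m : ℕ) : Matrix (Fin (m - 1)) (Fin m) ℂ :=
  Matrix.of fun i j => if (j : ℕ) = i + 1 then 1 else 0

/-- The Vandermonde matrix `[a^{(m)}(ω_1), …, a^{(m)}(ω_L)]`,
`a^{(m)}(ω) = [1, e^{jω}, …, e^{j(m-1)ω}]ᵀ`. -/
def vandermonde (m : ℕ) {L : ℕ} (ω : Fin L → ℝ) : Matrix (Fin m) (Fin L) ℂ :=
  Matrix.of fun i l => Complex.exp (Complex.I * (i : ℕ) * (ω l : ℂ))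

/-! ### The system -/

/-- Design data: `N n`, `M n` (`n = 1, …, 4`) are the beamspace and antenna dimensions, `M5` the
number of subcarriers, `K5` and `L5` the spatial smoothing sizes, `T n` the beamforming
matrices, `F n` and `Q n` the matrices by which the algorithm restores shift invariance, and
`Δf` the subcarrier spacing. -/
structure System where
  N : Fin 4 → ℕ
  M : Fin 4 → ℕ
  M5 : ℕ
  K5 : ℕ
  L5 : ℕ
  size : L5 + K5 = M5 + 1
  T : (n : Fin 4) → Matrix (Fin (M n)) (Fin (N n)) ℂ
  F : (n : Fin 4) → Matrix (Fin (N n)) (Fin (N n)) ℂ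
  Q : (n : Fin 4) → Matrix (Fin (N n)) (Fin (N n)) ℂ
  Δf : ℝ

namespace System

variable (S : System) {L : ℕ}

/-- Multi-indices `(n₁, n₂, n₃, n₄)`. -/
abbrev Beam : Type := (n : Fin 4) → Fin (S.N n)

/-- Index set of the vectorized beamspace channel, of size `N₁N₂N₃N₄M₅`. -/
abbrev Idx : Type := S.Beam × Fin S.M5

/-- Index set of the rows of the smoothed channel matrix, of size `N₁N₂N₃N₄K₅`. -/
abbrev SIdx : Type := S.Beam × Fin S.K5

/-- The column `t_{n,m}` of `T_nᴴ = [t_{n,1}, …, t_{n,M_n}]`. -/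
def t (n : Fin 4) (m : Fin (S.M n)) : Fin (S.N n) → ℂ := fun i => (S.T n)ᴴ i m

/-- `T n` has the shift invariance structure `J_{n,1} T_n = J_{n,2} T_n F_n` with `F_n`
non-singular, and `Q_n t_{n,M_n} = 0`, `Q_n F_nᴴ t_{n,1} = 0`. -/
structure ShiftInvariant : Prop where
  nonsing : ∀ n, IsUnit (S.F n)
  shift : ∀ n, selFirst (S.M n) * S.T n = selLast (S.M n) * S.T n * S.F n
  Q_last : ∀ n (m : Fin (S.M n)), (m : ℕ) + 1 = S.M n → S.Q n *ᵥ S.t n m = 0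
  Q_first : ∀ n (m : Fin (S.M n)), (m : ℕ) = 0 → S.Q n *ᵥ ((S.F n)ᴴ *ᵥ S.t n m) = 0

/-- Angular frequencies of a path. The components of `x` are the AOD azimuth and elevation, the
AOA azimuth and elevation, and the delay. -/
def angFreq (x : Fin 5 → ℝ) : Fin 5 → ℝ :=
  ![Real.pi * Real.sin (x 0) * Real.sin (x 1), Real.pi * Real.cos (x 1),
    Real.pi * Real.sin (x 2) * Real.sin (x 3), Real.pi * Real.cos (x 3),
    -(2 * Real.pi * S.Δf * x 4)]

/-- `e^{jω_n}`, `n = 1, …, 5`, for a path with parameters `x`. -/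
def phasor (x : Fin 5 → ℝ) (n : Fin 5) : ℂ := Complex.exp (Complex.I * (S.angFreq x n : ℂ))

/-- `B_n^{(N_n)} = T_nᴴ A_n^{(M_n)}`. -/
def modeB (ω : Fin L → Fin 5 → ℝ) (n : Fin 4) : Matrix (Fin (S.N n)) (Fin L) ℂ :=
  (S.T n)ᴴ * vandermonde (S.M n) (fun l => ω l n.castSucc)

/-- Khatri-Rao product `X₁ ⊙ X₂ ⊙ X₃ ⊙ X₄ ⊙ Y`. -/
def khatriRao {k : ℕ} (X : (n : Fin 4) → Matrix (Fin (S.N n)) (Fin L) ℂ)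
    (Y : Matrix (Fin k) (Fin L) ℂ) : Matrix (S.Beam × Fin k) (Fin L) ℂ :=
  Matrix.of fun p l => (∏ n, X n (p.1 n) l) * Y p.2 l

/-- `B = B_1 ⊙ B_2 ⊙ B_3 ⊙ B_4 ⊙ A_5^{(M_5)}`. -/
def matB (ω : Fin L → Fin 5 → ℝ) : Matrix S.Idx (Fin L) ℂ :=
  S.khatriRao (S.modeB ω) (vandermonde S.M5 (fun l => ω l 4))

/-- `P = B_1 ⊙ B_2 ⊙ B_3 ⊙ B_4 ⊙ A_5^{(K_5)}`. -/
def matP (ω : Fin L → Fin 5 → ℝ) : Matrix S.SIdx (Fin L) ℂ :=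
  S.khatriRao (S.modeB ω) (vandermonde S.K5 (fun l => ω l 4))

/-- `G = A_5^{(L_5)}`. -/
def matG (ω : Fin L → Fin 5 → ℝ) : Matrix (Fin S.L5) (Fin L) ℂ :=
  vandermonde S.L5 (fun l => ω l 4)

/-- The noiseless vectorized beamspace channel of the paths `(η_l, γ_l)`. -/
def channel (η : Fin L → Fin 5 → ℝ) (γ : Fin L → ℂ) : S.Idx → ℂ :=
  S.matB (fun l => S.angFreq (η l)) *ᵥ γ

/-- Spatial smoothing over the frequency domain: column `ℓ` of the result is
`(I ⊗ I ⊗ I ⊗ I ⊗ J_ℓ) h`. -/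
def smooth (h : S.Idx → ℂ) : Matrix S.SIdx (Fin S.L5) ℂ :=
  Matrix.of fun p ℓ => h (p.1, ⟨p.2 + ℓ, by have := S.size; have := p.2.2; have := ℓ.2; omega⟩)

/-- `I_{N_1} ⊗ ⋯ ⊗ X ⊗ ⋯ ⊗ I_{N_4} ⊗ I_{K_5}` with `X` in mode `n ≤ 4`. -/
def embedBeam (n : Fin 4) (X : Matrix (Fin (S.N n)) (Fin (S.N n)) ℂ) :
    Matrix S.SIdx S.SIdx ℂ :=
  Matrix.of fun p q => if (∀ m, m ≠ n → p.1 m = q.1 m) ∧ p.2 = q.2 then X (p.1 n) (q.1 n) else 0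

/-- `I_{N_1} ⊗ ⋯ ⊗ I_{N_4} ⊗ X`. -/
def embedFreq (X : Matrix (Fin (S.K5 - 1)) (Fin S.K5) ℂ) :
    Matrix (S.Beam × Fin (S.K5 - 1)) S.SIdx ℂ :=
  Matrix.of fun p q => if p.1 = q.1 then X p.2 q.2 else 0

/-- The modified selection matrices in modes `n ≤ 4`, with `L_{n,1} = Q_n`. -/
def J1Beam (n : Fin 4) : Matrix S.SIdx S.SIdx ℂ := S.embedBeam n (S.Q n)

/-- The modified selection matrices in modes `n ≤ 4`, with `L_{n,2} = Q_n F_nᴴ`. -/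
def J2Beam (n : Fin 4) : Matrix S.SIdx S.SIdx ℂ := S.embedBeam n (S.Q n * (S.F n)ᴴ)

def J1Freq : Matrix (S.Beam × Fin (S.K5 - 1)) S.SIdx ℂ := S.embedFreq (selFirst S.K5)

def J2Freq : Matrix (S.Beam × Fin (S.K5 - 1)) S.SIdx ℂ := S.embedFreq (selLast S.K5)

/-! ### The matrix-based beamspace ESPRIT algorithm -/

/-- Least-squares solution `Γ_n = (J_{n,1} U)† (J_{n,2} U)` of the shift equation in mode `n`. -/
def Gam (U : Matrix S.SIdx (Fin L) ℂ) (n : Fin 5) : Matrix (Fin L) (Fin L) ℂ :=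
  Fin.lastCases (motive := fun _ => Matrix (Fin L) (Fin L) ℂ)
    (pinv (S.J1Freq * U) * (S.J2Freq * U))
    (fun m => pinv (S.J1Beam m * U) * (S.J2Beam m * U)) n

/-- `(ηh, γh)` is an output of the algorithm on the input `h`, with weights `β` in the joint
eigenvalue decomposition: `U` is the signal subspace of the smoothed channel matrix,
`K = ∑ β_n Γ_n` is diagonalized by `E`, the angular frequencies are
`Im ln (E⁻¹ Γ_n E)_{l,l}`, the angles and the delay are the point of the parameter domain `D`
with these angular frequencies (modulo `2π`), and the gains are `B̂† h`. -/
def IsOutput (D : Set (Fin 5 → ℝ)) (β : Fin 5 → ℂ) (h : S.Idx → ℂ)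
    (ηh : Fin L → Fin 5 → ℝ) (γh : Fin L → ℂ) : Prop :=
  ∃ (U : Matrix S.SIdx (Fin L) ℂ) (E : Matrix (Fin L) (Fin L) ℂ) (ω : Fin L → Fin 5 → ℝ),
    IsLeadingLeftSingular (S.smooth h) U ∧
    IsUnit E ∧
    (E⁻¹ * (∑ n, β n • S.Gam U n) * E).IsDiag ∧
    (∀ l n, ω l n = (Complex.log ((E⁻¹ * S.Gam U n * E) l l)).im) ∧
    (∀ l, ηh l ∈ D ∧ ∀ n, S.phasor (ηh l) n = Complex.exp (Complex.I * (ω l n : ℂ))) ∧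
    γh = pinv (S.matB ω) *ᵥ h

/-- The real-linear maps `δη l i` (`i`-th component of `η_l`) and `δγ l` give the first-order
perturbations of the estimates: near the noiseless channel the algorithm has an output, and each
of its outputs on `h + d` is, after the paths are matched, equal to
`η_l + δη l (d) + o(‖d‖)`, `γ_l + δγ l (d) + o(‖d‖)`. -/
def IsFirstOrderPerturbation (D : Set (Fin 5 → ℝ)) (β : Fin 5 → ℂ)
    (η : Fin L → Fin 5 → ℝ) (γ : Fin L → ℂ)
    (δη : Fin L → Fin 5 → (S.Idx → ℂ) →L[ℝ] ℝ) (δγ : Fin L → (S.Idx → ℂ) →L[ℝ] ℂ) : Prop :=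
  ∀ ε : ℝ, 0 < ε → ∃ r : ℝ, 0 < r ∧ ∀ d : S.Idx → ℂ, ‖d‖ < r →
    (∃ (ηh : Fin L → Fin 5 → ℝ) (γh : Fin L → ℂ),
      S.IsOutput D β (S.channel η γ + d) ηh γh) ∧
    ∀ (ηh : Fin L → Fin 5 → ℝ) (γh : Fin L → ℂ), S.IsOutput D β (S.channel η γ + d) ηh γh →
      ∃ σ : Equiv.Perm (Fin L), ∀ l,
        (∀ i, |ηh (σ l) i - η l i - δη l i d| ≤ ε * ‖d‖) ∧
        ‖γh (σ l) - γ l - δγ l d‖ ≤ ε * ‖d‖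

/-! ### The closed-form quantities -/

/-- `λ` with `λᴴ = b_lᵀ (J₁ P)† (J₂ - z J₁)`. -/
def lamOf {r : Type*} [Fintype r] (J1 J2 : Matrix r S.SIdx ℂ) (P : Matrix S.SIdx (Fin L) ℂ)
    (z : ℂ) (l : Fin L) : S.SIdx → ℂ :=
  fun q => star ((pinv (J1 * P) * (J2 - z • J1)) l q)

/-- `λ_{l,n}`. -/
def lam (η : Fin L → Fin 5 → ℝ) (l : Fin L) (n : Fin 5) : S.SIdx → ℂ :=
  Fin.lastCases (motive := fun _ => S.SIdx → ℂ)
    (S.lamOf S.J1Freq S.J2Freq (S.matP fun l => S.angFreq (η l)) (S.phasor (η l) 4) l)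
    (fun m => S.lamOf (S.J1Beam m) (S.J2Beam m) (S.matP fun l => S.angFreq (η l))
      (S.phasor (η l) m.castSucc) l) n

/-- `χ_l` with `χ_l^* = (Gᵀ)† b_l`. -/
def chi (η : Fin L → Fin 5 → ℝ) (l : Fin L) : Fin S.L5 → ℂ :=
  fun ℓ => star (pinv (S.matG fun l => S.angFreq (η l))ᵀ ℓ l)

/-- `ξ_{l,n}`: blockwise convolution of `λ_{l,n}` and `χ_l`. -/
def xi (η : Fin L → Fin 5 → ℝ) (l : Fin L) (n : Fin 5) : S.Idx → ℂ :=
  fun p => ∑ k : Fin S.K5, ∑ ℓ : Fin S.L5,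
    if (k : ℕ) + ℓ = p.2 then S.lam η l n (p.1, k) * S.chi η l ℓ else 0

/-- `υ_{l,n} = Φ_{l,n} ξ_{l,n} / γ_l^*`. -/
def upsilon (η : Fin L → Fin 5 → ℝ) (γ : Fin L → ℂ) (l : Fin L) (n : Fin 5) : S.Idx → ℂ :=
  (S.phasor (η l) n / star (γ l)) • S.xi η l n

/-- `V_n = [υ_{1,n}, …, υ_{L,n}]`. -/
def matV (η : Fin L → Fin 5 → ℝ) (γ : Fin L → ℂ) (n : Fin 5) : Matrix S.Idx (Fin L) ℂ :=
  Matrix.of fun p l => S.upsilon η γ l n p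

/-- The vectors `κ_{l,1}, …, κ_{l,5}`. -/
def kappa (η : Fin L → Fin 5 → ℝ) (γ : Fin L → ℂ) (l : Fin L) : Fin 5 → S.Idx → ℂ :=
  ![(1 / (Real.pi * Real.cos (η l 0) * Real.sin (η l 1))) • S.upsilon η γ l 0
      + (Real.sin (η l 0) * Real.cos (η l 1)
          / (Real.pi * Real.cos (η l 0) * Real.sin (η l 1) ^ 2)) • S.upsilon η γ l 1,
    (1 / (Real.pi * Real.sin (η l 1))) • S.upsilon η γ l 1,
    (1 / (Real.pi * Real.cos (η l 2) * Real.sin (η l 3))) • S.upsilon η γ l 2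
      + (Real.sin (η l 2) * Real.cos (η l 3)
          / (Real.pi * Real.cos (η l 2) * Real.sin (η l 3) ^ 2)) • S.upsilon η γ l 3,
    (1 / (Real.pi * Real.sin (η l 3))) • S.upsilon η γ l 3,
    (1 / (2 * Real.pi * S.Δf)) • S.upsilon η γ l 4]

/-- `T̆ = -j Diag(0, 1, …, m-1) T`. -/
def breveT {m k : ℕ} (T : Matrix (Fin m) (Fin k) ℂ) : Matrix (Fin m) (Fin k) ℂ :=
  -(Complex.I • (Matrix.diagonal (fun i : Fin m => ((i : ℕ) : ℂ)) * T))

/-- `B̆_n`: the factor `B_n` of `B` is replaced by `T̆_nᴴ A_n^{(M_n)}` (with `T_5 = I`). -/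
def breveB (ω : Fin L → Fin 5 → ℝ) (n : Fin 5) : Matrix S.Idx (Fin L) ℂ :=
  Fin.lastCases (motive := fun _ => Matrix S.Idx (Fin L) ℂ)
    (S.khatriRao (S.modeB ω)
      ((breveT (1 : Matrix (Fin S.M5) (Fin S.M5) ℂ))ᴴ * vandermonde S.M5 (fun l => ω l 4)))
    (fun m => S.khatriRao
      (Function.update (S.modeB ω) m
        ((breveT (S.T m))ᴴ * vandermonde (S.M m) (fun l => ω l m.castSucc)))
      (vandermonde S.M5 (fun l => ω l 4))) n

/-- `Υ_n = B† B̆_n ⊙ γᵀ`. -/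
def Ups (η : Fin L → Fin 5 → ℝ) (γ : Fin L → ℂ) (n : Fin 5) : Matrix (Fin L) (Fin L) ℂ :=
  pinv (S.matB fun l => S.angFreq (η l)) * S.breveB (fun l => S.angFreq (η l)) n
    * Matrix.diagonal γ

/-- Entrywise real part of a matrix. -/
def reM {m n : Type*} (A : Matrix m n ℂ) : Matrix m n ℝ := A.map Complex.re

/-- Entrywise imaginary part of a matrix. -/
def imM {m n : Type*} (A : Matrix m n ℂ) : Matrix m n ℝ := A.map Complex.im

/-- The matrix `Π_l`. -/
def matPi (η : Fin L → Fin 5 → ℝ) (γ : Fin L → ℂ) (l : Fin L) :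
    Matrix (Unit ⊕ Unit) (S.Idx ⊕ S.Idx) ℝ :=
  let b : Matrix Unit S.Idx ℂ :=
    Matrix.replicateRow Unit (pinv (S.matB fun l => S.angFreq (η l)) l)
  let u : Fin 5 → Matrix Unit (Fin L) ℂ := fun n => Matrix.replicateRow Unit (S.Ups η γ n l)
  Matrix.fromBlocks (reM b) (-imM b) (imM b) (reM b)
    - ∑ n, Matrix.fromRows (reM (u n)) (imM (u n))
        * Matrix.fromCols (imM (S.matV η γ n)ᴴ) (reM (S.matV η γ n)ᴴ)

end System

/-- Squared Euclidean norm. -/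
def sqNorm {ι : Type*} [Fintype ι] (v : ι → ℂ) : ℝ := ∑ i, ‖v i‖ ^ 2

/-- Squared Frobenius norm. -/
def frobSq {m n : Type*} [Fintype m] [Fintype n] (A : Matrix m n ℝ) : ℝ := ∑ i, ∑ j, A i j ^ 2

/-- The zero-mean circular complex Gaussian law of variance `v`: the real and imaginary parts are
independent real Gaussians of mean `0` and variance `v / 2`. -/
def circularGaussian (v : ℝ) : Measure ℂ :=
  ((gaussianReal 0 (v / 2).toNNReal).prod (gaussianReal 0 (v / 2).toNNReal)).map
    (fun p : ℝ × ℝ => (⟨p.1, p.2⟩ : ℂ))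

end BeamspaceESPRIT

end

noncomputable section

namespace BeamspaceESPRIT

set_option linter.unusedSectionVars false

/-! ### The Moore-Penrose inverse -/

section PInv

variable {m n : Type*} [Fintype m] [Fintype n]

/-! The noiseless smoothed matrix factors as `P R` with `R = Diag(γ) Gᵀ` (`smooth_channel`), and in
every mode the selection matrices satisfy `J₂ P = J₁ P Φ` with `Φ` the diagonal matrix of phasors
(`shift_matP_freq`, `shift_matP_beam`). Hence without noise all `Γ_n` are diagonalized by one common
matrix. The task is to follow an error `d` to first order through every stage, uniformly over the
choices that the algorithm leaves open: the singular basis, the eigenvector matrix and the order of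
the paths.

Singular vectors need not depend continuously on `d`, so they are never expanded. Let `Y` be a right
inverse of `R` with columns in the range of `Rᴴ`. For small `d` the matrix `U (Uᴴ H Y)` has the same
column space as `U`, and it equals `P + S(d) Y + O(‖d‖²)`, where `S` is spatial smoothing
(`norm_signal_basis_sub_le`). A change of basis conjugates all `Γ_n` by the same matrix and leaves
the algorithm's eigenvalues alone, so the expansion is made in this basis.

There `shift_solution_expansion` linearizes `Γ_n`; the inverse function theorem gives a
diagonalizing matrix `1 + O(‖d‖)` (`exists_eigenbasis`), which does not affect diagonals in first
order (`diag_conj_expansion`); and as the eigenvalues of `∑ β_n Γ_n` are distinct, every other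
diagonalizer yields the same numbers in another order (`exists_perm_diag_conj`). The adjoint of
smoothing is a blockwise convolution, so the linear term is a pairing of `d` with `υ`
(`upsilon_pairing`).

The frequency errors are thus `Im (υᴴ d)` (`phase_expansion`). Inverting the Jacobian of the angular
frequencies turns `υ` into `κ` up to sign (`param_expansion`), and linearizing `B† h` gives the gain
error (`gain_expansion`), whose real coefficients are the rows of `Π_l` (`gainPert_re_im`).

Linear maps that describe the same outputs to first order coincide
(`IsFirstOrderPerturbation.unique`), so only the explicit maps need moments. A real functional of
circular noise has second moment `v / 2` times the sum of its squared coefficients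
(`noise_functional`), which produces the norms of `κ` and `Π_l`. -/

theorem IsMoorePenrose.unique {A : Matrix m n ℂ} {X Y : Matrix n m ℂ}
    (hX : IsMoorePenrose A X) (hY : IsMoorePenrose A Y) : X = Y := by
  have h1 : A * X = A * Y := by
    calc A * X = (A * X)ᴴ := hX.left_herm.symm
      _ = (A * Y * A * X)ᴴ := by rw [hY.mul_mul_self]
      _ = (A * X)ᴴ * (A * Y)ᴴ := by rw [← Matrix.conjTranspose_mul, Matrix.mul_assoc (A * Y)]
      _ = A * X * A * Y := by rw [hX.left_herm, hY.left_herm, Matrix.mul_assoc (A * X)]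
      _ = A * Y := by rw [hX.mul_mul_self]
  have h2 : X * A = Y * A := by
    calc X * A = (X * A)ᴴ := hX.right_herm.symm
      _ = (X * (A * Y * A))ᴴ := by rw [hY.mul_mul_self]
      _ = (Y * A)ᴴ * (X * A)ᴴ := by
        rw [← Matrix.conjTranspose_mul]; simp only [Matrix.mul_assoc]
      _ = Y * (A * X * A) := by
        rw [hX.right_herm, hY.right_herm]; simp only [Matrix.mul_assoc]
      _ = Y * A := by rw [hX.mul_mul_self]
  calc X = X * A * X := hX.self_mul_mul.symm
    _ = Y * (A * X) := by rw [h2, Matrix.mul_assoc]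
    _ = Y * A * Y := by rw [h1, Matrix.mul_assoc]
    _ = Y := hY.self_mul_mul

/-- Uniqueness makes the `Classical.epsilon` choice computable: any solution of the Penrose
equations is the chosen one. -/
theorem pinv_eq {A : Matrix m n ℂ} {X : Matrix n m ℂ} (hX : IsMoorePenrose A X) : pinv A = X :=
  (Classical.epsilon_spec (p := IsMoorePenrose A) ⟨X, hX⟩).unique hX

variable [DecidableEq n] [DecidableEq m]

theorem rank_gram (A : Matrix m n ℂ) : (Aᴴ * A).rank = A.rank := by
  open scoped ComplexOrder in exact Matrix.rank_conjTranspose_mul_self A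

theorem isUnit_gram_of_rank {A : Matrix m n ℂ} (h : A.rank = Fintype.card n) :
    IsUnit (Aᴴ * A) := by
  rw [← rank_gram] at h
  rw [← Matrix.mulVec_surjective_iff_isUnit]
  have ht : LinearMap.range (Aᴴ * A).mulVecLin = ⊤ := by
    refine Submodule.eq_top_of_finrank_eq ?_
    rw [Module.finrank_fintype_fun_eq_card]
    exact h
  exact LinearMap.range_eq_top.1 ht

theorem isUnit_gram_of_mul_eq_one {A : Matrix m n ℂ} {C : Matrix n m ℂ} (h : C * A = 1) :
    IsUnit (Aᴴ * A) := by
  refine isUnit_gram_of_rank (le_antisymm (Matrix.rank_le_card_width A) ?_)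
  have := Matrix.rank_mul_le_right C A
  rwa [h, Matrix.rank_one] at this

theorem pinv_of_isUnit_gram {A : Matrix m n ℂ} (h : IsUnit (Aᴴ * A)) :
    pinv A = (Aᴴ * A)⁻¹ * Aᴴ := by
  have hd := (Matrix.isUnit_iff_isUnit_det _).1 h
  have h1 : (Aᴴ * A)⁻¹ * Aᴴ * A = 1 := by rw [Matrix.mul_assoc, Matrix.nonsing_inv_mul _ hd]
  refine pinv_eq ⟨?_, ?_, ?_, ?_⟩
  · rw [Matrix.mul_assoc, h1, Matrix.mul_one]
  · rw [h1, Matrix.one_mul]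
  · simp [Matrix.conjTranspose_mul, Matrix.conjTranspose_nonsing_inv, Matrix.mul_assoc]
  · rw [h1, Matrix.conjTranspose_one]

theorem pinv_mul_self {A : Matrix m n ℂ} (h : IsUnit (Aᴴ * A)) : pinv A * A = 1 := by
  rw [pinv_of_isUnit_gram h, Matrix.mul_assoc,
    Matrix.nonsing_inv_mul _ ((Matrix.isUnit_iff_isUnit_det _).1 h)]

theorem pinv_of_isUnit_cogram {A : Matrix m n ℂ} (h : IsUnit (A * Aᴴ)) :
    pinv A = Aᴴ * (A * Aᴴ)⁻¹ := by
  have hd := (Matrix.isUnit_iff_isUnit_det _).1 h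
  have h1 : A * (Aᴴ * (A * Aᴴ)⁻¹) = 1 := by rw [← Matrix.mul_assoc, Matrix.mul_nonsing_inv _ hd]
  refine pinv_eq ⟨?_, ?_, ?_, ?_⟩
  · rw [h1, Matrix.one_mul]
  · rw [Matrix.mul_assoc, h1, Matrix.mul_one]
  · rw [h1, Matrix.conjTranspose_one]
  · simp [Matrix.conjTranspose_mul, Matrix.conjTranspose_nonsing_inv, Matrix.mul_assoc]

/-- Reversal fails for general pseudoinverses. Here `A C` and `A` have the same range, so both
products with the pseudoinverse give the same orthogonal projection. -/
theorem pinv_mul_isUnit {A : Matrix m n ℂ} {C : Matrix n n ℂ} (hA : IsUnit (Aᴴ * A))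
    (hC : IsUnit C) : pinv (A * C) = C⁻¹ * pinv A := by
  have hCd := (Matrix.isUnit_iff_isUnit_det _).1 hC
  have hP := pinv_mul_self hA
  have h0 := pinv_of_isUnit_gram hA
  have hH : (A * pinv A)ᴴ = A * pinv A := by
    rw [h0]; simp [Matrix.conjTranspose_mul, Matrix.conjTranspose_nonsing_inv, Matrix.mul_assoc]
  have e1 : A * C * (C⁻¹ * pinv A) = A * pinv A := by
    rw [Matrix.mul_assoc, ← Matrix.mul_assoc C, Matrix.mul_nonsing_inv _ hCd, Matrix.one_mul]
  have e2 : C⁻¹ * pinv A * (A * C) = 1 := by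
    rw [Matrix.mul_assoc, ← Matrix.mul_assoc (pinv A), hP, Matrix.one_mul,
      Matrix.nonsing_inv_mul _ hCd]
  refine pinv_eq ⟨?_, ?_, ?_, ?_⟩
  · rw [Matrix.mul_assoc, e2, Matrix.mul_one]
  · rw [e2, Matrix.one_mul]
  · rw [e1, hH]
  · rw [e2, Matrix.conjTranspose_one]

theorem submatrix_perm_eq_mul (A : Matrix m n ℂ) (σ : Equiv.Perm n) :
    A.submatrix id σ = A * (1 : Matrix n n ℂ).submatrix id σ := by
  rw [← Matrix.submatrix_id_id A, Matrix.submatrix_submatrix]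
  ext i j
  simp [Matrix.mul_apply, Matrix.one_apply]

theorem pinv_submatrix_perm {A : Matrix m n ℂ} (hA : IsUnit (Aᴴ * A)) (σ : Equiv.Perm n) :
    pinv (A.submatrix id σ) = (pinv A).submatrix σ id := by
  have h1 : (1 : Matrix n n ℂ).submatrix σ id * (1 : Matrix n n ℂ).submatrix id σ = 1 := by
    ext i j
    simp [Matrix.mul_apply, Matrix.one_apply]
  have hu : IsUnit ((1 : Matrix n n ℂ).submatrix id σ) :=
    IsUnit.of_mul_eq_one_right _ h1
  rw [submatrix_perm_eq_mul, pinv_mul_isUnit hA hu, Matrix.inv_eq_left_inv h1]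
  ext i j
  simp [Matrix.mul_apply, Matrix.one_apply]

/-! ### Continuity of products, inverses and pseudoinverses -/

section Limits

open Filter Topology

variable {α : Type*} {l : Filter α}

theorem tendsto_matrix_mul {p : Type*} [Fintype p] [DecidableEq p] {A : α → Matrix m n ℂ}
    {B : α → Matrix n p ℂ} {A₀ : Matrix m n ℂ} {B₀ : Matrix n p ℂ} (hA : Tendsto A l (𝓝 A₀))
    (hB : Tendsto B l (𝓝 B₀)) : Tendsto (fun a => A a * B a) l (𝓝 (A₀ * B₀)) := by
  refine tendsto_pi_nhds.2 fun i => tendsto_pi_nhds.2 fun j => ?_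
  simp only [Matrix.mul_apply]
  exact tendsto_finsetSum _ fun k _ =>
    (tendsto_pi_nhds.1 (tendsto_pi_nhds.1 hA i) k).mul (tendsto_pi_nhds.1 (tendsto_pi_nhds.1 hB k) j)

theorem tendsto_conjTranspose {A : α → Matrix m n ℂ} {A₀ : Matrix m n ℂ}
    (hA : Tendsto A l (𝓝 A₀)) : Tendsto (fun a => (A a)ᴴ) l (𝓝 A₀ᴴ) :=
  ((continuous_id.matrix_conjTranspose).tendsto A₀).comp hA

open scoped Matrix.Norms.L2Operator in
theorem eventually_isUnit {A : α → Matrix n n ℂ} {A₀ : Matrix n n ℂ}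
    (hA : Tendsto A l (𝓝 A₀)) (h : IsUnit A₀) : ∀ᶠ a in l, IsUnit (A a) :=
  hA.eventually (Units.isOpen.mem_nhds h)

open scoped Matrix.Norms.L2Operator in
theorem tendsto_matrix_inv {A : α → Matrix n n ℂ} {A₀ : Matrix n n ℂ}
    (hA : Tendsto A l (𝓝 A₀)) (h : IsUnit A₀) : Tendsto (fun a => (A a)⁻¹) l (𝓝 A₀⁻¹) := by
  obtain ⟨u, rfl⟩ := h
  have := (NormedRing.inverse_continuousAt u).tendsto.comp hA
  simpa only [Matrix.nonsing_inv_eq_ringInverse, Function.comp_def] using this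

theorem eventually_isUnit_gram {A : α → Matrix m n ℂ} {A₀ : Matrix m n ℂ}
    (hA : Tendsto A l (𝓝 A₀)) (h : IsUnit (A₀ᴴ * A₀)) : ∀ᶠ a in l, IsUnit ((A a)ᴴ * A a) :=
  eventually_isUnit (tendsto_matrix_mul (tendsto_conjTranspose hA) hA) h

/-- The pseudoinverse is discontinuous where the rank drops. At full column rank it is `(AᴴA)⁻¹Aᴴ`,
and this formula persists nearby. -/
theorem tendsto_pinv {A : α → Matrix m n ℂ} {A₀ : Matrix m n ℂ}
    (hA : Tendsto A l (𝓝 A₀)) (h : IsUnit (A₀ᴴ * A₀)) :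
    Tendsto (fun a => pinv (A a)) l (𝓝 (pinv A₀)) := by
  have hg := tendsto_matrix_mul (tendsto_conjTranspose hA) hA
  rw [pinv_of_isUnit_gram h]
  refine (tendsto_matrix_mul (tendsto_matrix_inv hg h) (tendsto_conjTranspose hA)).congr' ?_
  filter_upwards [eventually_isUnit_gram hA h] with a ha
  rw [pinv_of_isUnit_gram ha]

end Limits

end PInv

/-! ### Existence of leading left singular vectors -/

section SVD

variable {m n : Type*} [Fintype m] [Fintype n] [DecidableEq n] [DecidableEq m]

theorem fromCols_mul_diagonal_mul {L k : ℕ} (Us : Matrix m (Fin L) ℂ) (Un : Matrix m (Fin k) ℂ)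
    (Vs : Matrix n (Fin L) ℂ) (Vn : Matrix n (Fin k) ℂ) (s : Fin L → ℝ) (t : Fin k → ℝ) :
    Matrix.fromCols Us Un * Matrix.diagonal (fun i => ((Sum.elim s t i : ℝ) : ℂ))
        * (Matrix.fromCols Vs Vn)ᴴ
      = Us * Matrix.diagonal (fun i => (s i : ℂ)) * Vsᴴ
        + Un * Matrix.diagonal (fun j => (t j : ℂ)) * Vnᴴ := by
  ext p q
  simp [Matrix.mul_apply, Matrix.diagonal_apply, Fintype.sum_sum_type]

theorem exists_sorted_equiv {ι : Type*} [Fintype ι] (f : ι → ℝ) :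
    ∃ e : Fin (Fintype.card ι) ≃ ι, Antitone (f ∘ e) := by
  let e₀ := (Fintype.equivFin ι).symm
  refine ⟨(Tuple.sort fun i => -f (e₀ i)).trans e₀, fun i j hij => ?_⟩
  have := Tuple.monotone_sort (fun i => -f (e₀ i)) hij
  simpa using this

/-- A compact singular value decomposition from the spectral theorem for `HᴴH`. The bound on `L`
allows the leading vectors to be taken among those with positive singular values, where left vectors
are obtained by normalizing `H w`. -/
theorem exists_isLeadingLeftSingular {L : ℕ} (H : Matrix m n ℂ) (hL : L ≤ H.rank) :
    ∃ U : Matrix m (Fin L) ℂ, IsLeadingLeftSingular H U := by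
  have hA : (Hᴴ * H).IsHermitian := Matrix.isHermitian_conjTranspose_mul_self H
  have hpos : ∀ i, 0 ≤ hA.eigenvalues i := fun i =>
    (open scoped ComplexOrder in (Matrix.posSemidef_conjTranspose_mul_self H)).eigenvalues_nonneg i
  set V : Matrix n n ℂ := (hA.eigenvectorUnitary : Matrix n n ℂ) with hV
  have hVV : Vᴴ * V = 1 := Matrix.mem_unitaryGroup_iff'.1 hA.eigenvectorUnitary.2
  have hVV' : V * Vᴴ = 1 := Matrix.mem_unitaryGroup_iff.1 hA.eigenvectorUnitary.2
  have hsp : Vᴴ * (Hᴴ * H) * V = Matrix.diagonal (fun i => (hA.eigenvalues i : ℂ)) := by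
    have := hA.conjStarAlgAut_star_eigenvectorUnitary
    rw [Unitary.conjStarAlgAut_apply] at this
    simp only [Unitary.coe_star, Matrix.star_eq_conjTranspose,
      Matrix.conjTranspose_conjTranspose] at this
    exact this
  have hcard : Fintype.card {i // hA.eigenvalues i ≠ 0} = H.rank := by
    rw [← rank_gram, hA.rank_eq_card_non_zero_eigs]
  obtain ⟨e, he⟩ := exists_sorted_equiv (fun i : {i // hA.eigenvalues i ≠ 0} => hA.eigenvalues i)
  obtain ⟨k, hk⟩ := Nat.exists_eq_add_of_le (hcard ▸ hL)
  -- The nonzero eigenvalues in decreasing order, split after the first `L`.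
  let g : Fin L ⊕ Fin k ≃ {i // hA.eigenvalues i ≠ 0} :=
    finSumFinEquiv.trans ((finCongr hk.symm).trans e)
  have hg : Function.Injective fun x => (g x : n) := Subtype.val_injective.comp g.injective
  let σ : Fin L ⊕ Fin k → ℝ := fun x => Real.sqrt (hA.eigenvalues (g x))
  have hσ : ∀ x, 0 < σ x := fun x =>
    Real.sqrt_pos.2 (lt_of_le_of_ne (hpos _) (g x).2.symm)
  let W : Matrix n (Fin L ⊕ Fin k) ℂ := V.submatrix id (fun x => (g x : n))
  let Z : Matrix m (Fin L ⊕ Fin k) ℂ := H * W * Matrix.diagonal (fun x => ((σ x : ℂ))⁻¹)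
  have hW : Wᴴ * W = 1 := by
    have : Wᴴ * W = (Vᴴ * V).submatrix (fun x => (g x : n)) (fun x => (g x : n)) := by
      ext; simp [W, Matrix.mul_apply]
    rw [this, hVV, Matrix.submatrix_one _ hg]
  have hWH : Wᴴ * (Hᴴ * H) * W = Matrix.diagonal (fun x => ((σ x : ℂ)) * σ x) := by
    have : Wᴴ * (Hᴴ * H) * W
        = (Vᴴ * (Hᴴ * H) * V).submatrix (fun x => (g x : n)) (fun x => (g x : n)) := by
      ext; simp [W, Matrix.mul_apply]
    rw [this, hsp, Matrix.submatrix_diagonal _ _ hg]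
    congr 1
    ext x
    simp only [Function.comp, σ]
    rw [← Complex.ofReal_mul, Real.mul_self_sqrt (hpos _)]
  have hne : ∀ x, (σ x : ℂ) ≠ 0 := fun x => Complex.ofReal_ne_zero.2 (hσ x).ne'
  have hZ : Zᴴ * Z = 1 := by
    have : Zᴴ * Z = Matrix.diagonal (fun x => ((σ x : ℂ))⁻¹) * (Wᴴ * (Hᴴ * H) * W)
        * Matrix.diagonal (fun x => ((σ x : ℂ))⁻¹) := by
      have hd : (Matrix.diagonal (fun x => ((σ x : ℂ))⁻¹))ᴴ
          = Matrix.diagonal (fun x => ((σ x : ℂ))⁻¹) := by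
        rw [Matrix.diagonal_conjTranspose]
        congr 1
        ext x
        simp
      simp only [Z, Matrix.conjTranspose_mul, hd, Matrix.mul_assoc]
    rw [this, hWH, Matrix.diagonal_mul_diagonal, Matrix.diagonal_mul_diagonal,
      ← Matrix.diagonal_one]
    congr 1
    ext x
    field_simp [hne x]
  -- Eigenvectors of `HᴴH` with eigenvalue zero are killed by `H`, so discarding them loses nothing
  -- in `H = H V Vᴴ`.
  have hzero : ∀ p i, hA.eigenvalues i = 0 → (H * V) p i = 0 := by
    intro p i hi
    have h1 : ((H * V)ᴴ * (H * V)) i i = 0 := by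
      have : (H * V)ᴴ * (H * V) = Vᴴ * (Hᴴ * H) * V := by
        simp [Matrix.conjTranspose_mul, Matrix.mul_assoc]
      rw [this, hsp, Matrix.diagonal_apply_eq, hi, Complex.ofReal_zero]
    have h2 : ∑ q, ‖(H * V) q i‖ ^ 2 = 0 := by
      rw [Matrix.mul_apply] at h1
      simp only [Matrix.conjTranspose_apply, RCLike.star_def, Complex.conj_mul'] at h1
      exact_mod_cast h1
    have := (Finset.sum_eq_zero_iff_of_nonneg (fun q _ => sq_nonneg _)).1 h2 p (Finset.mem_univ _)
    simpa using this
  have hdec : H = Z * Matrix.diagonal (fun x => (σ x : ℂ)) * Wᴴ := by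
    have h1 : Z * Matrix.diagonal (fun x => (σ x : ℂ)) = H * W := by
      simp only [Z, Matrix.mul_assoc, Matrix.diagonal_mul_diagonal]
      have : (Matrix.diagonal fun x => ((σ x : ℂ))⁻¹ * σ x) = 1 := by
        rw [← Matrix.diagonal_one]
        congr 1
        ext x
        field_simp [hne x]
      rw [this, Matrix.mul_one]
    rw [h1]
    conv_lhs => rw [← Matrix.mul_one H, ← hVV', ← Matrix.mul_assoc]
    ext p q
    have h2 : (H * W * Wᴴ) p q = ∑ x, (H * V) p (g x) * Vᴴ (g x) q := by
      simp [W, Matrix.mul_apply]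
    rw [h2, Matrix.mul_apply, Equiv.sum_comp g (fun y => (H * V) p y * Vᴴ y q)]
    rw [← Finset.sum_subtype (Finset.univ.filter fun i => hA.eigenvalues i ≠ 0) (by simp)
      fun y => (H * V) p y * Vᴴ y q]
    symm
    apply Finset.sum_filter_of_ne
    intro i _ hi h0
    exact hi (by rw [hzero p i h0, zero_mul])
  refine ⟨Z.toCols₁, k, fun i => σ (Sum.inl i), W.toCols₁, Z.toCols₂, fun i => σ (Sum.inr i),
    W.toCols₂, ?_, ?_, fun i => (hσ _).le, fun i => (hσ _).le, fun i j => ?_, ?_⟩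
  · rw [Matrix.fromCols_toCols, hZ]
  · rw [Matrix.fromCols_toCols, hW]
  · refine Real.sqrt_le_sqrt (he ?_)
    simp [Fin.le_def]
    omega
  · rw [← fromCols_mul_diagonal_mul, Matrix.fromCols_toCols, Matrix.fromCols_toCols]
    have : (fun x => ((Sum.elim (fun i => σ (Sum.inl i)) (fun i => σ (Sum.inr i)) x : ℝ) : ℂ))
        = fun x => (σ x : ℂ) := by
      ext x
      cases x <;> rfl
    rw [this, ← hdec]

end SVD

/-! ### Perturbation of the signal subspace -/

section SignalSubspace

open scoped Matrix.Norms.L2Operator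

variable {m n : Type*} [Fintype m] [Fintype n] [DecidableEq n] [DecidableEq m]

theorem ofReal_norm_sq_eq_star_dotProduct (y : n → ℂ) :
    ((‖WithLp.toLp 2 y‖ ^ 2 : ℝ) : ℂ) = star y ⬝ᵥ y := by
  rw [EuclideanSpace.norm_sq_eq, dotProduct]
  push_cast
  exact Finset.sum_congr rfl fun i _ => by simp [Complex.conj_mul']

theorem norm_isometry_mulVec {Z : Matrix m n ℂ} (hZ : Zᴴ * Z = 1) (x : n → ℂ) :
    ‖WithLp.toLp 2 (Z *ᵥ x)‖ = ‖WithLp.toLp 2 x‖ := by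
  have h : ((‖WithLp.toLp 2 (Z *ᵥ x)‖ ^ 2 : ℝ) : ℂ) = ((‖WithLp.toLp 2 x‖ ^ 2 : ℝ) : ℂ) := by
    rw [ofReal_norm_sq_eq_star_dotProduct, ofReal_norm_sq_eq_star_dotProduct,
      Matrix.star_mulVec, Matrix.dotProduct_mulVec, Matrix.vecMul_vecMul, hZ, Matrix.vecMul_one]
  exact (sq_eq_sq₀ (norm_nonneg _) (norm_nonneg _)).1 (by exact_mod_cast h)

theorem norm_isometry_le {Z : Matrix m n ℂ} (hZ : Zᴴ * Z = 1) : ‖Z‖ ≤ 1 := by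
  have h := Matrix.l2_opNorm_conjTranspose_mul_self Z
  have h1 : ‖(1 : Matrix n n ℂ)‖ ≤ 1 := by
    rw [← Matrix.diagonal_one, Matrix.l2_opNorm_diagonal]
    exact (pi_norm_le_iff_of_nonneg zero_le_one).2 fun i => by simp
  rw [hZ] at h
  nlinarith [norm_nonneg Z]

/-- A matrix that is within `‖Δ‖` of a product through a space of dimension `L` has only `L`
singular values larger than `‖Δ‖`. -/
theorem singularValue_le {L k : ℕ} {P : Matrix m (Fin L) ℂ} {R : Matrix (Fin L) n ℂ}
    {Δ : Matrix m n ℂ} {Z : Matrix m (Fin L ⊕ Fin k) ℂ} {W : Matrix n (Fin L ⊕ Fin k) ℂ}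
    {s : Fin L → ℝ} {t : Fin k → ℝ} (hZ : Zᴴ * Z = 1) (hW : Wᴴ * W = 1)
    (ht : ∀ j, 0 ≤ t j) (hst : ∀ i j, t j ≤ s i)
    (hH : P * R + Δ = Z * Matrix.diagonal (fun i => ((Sum.elim s t i : ℝ) : ℂ)) * Wᴴ)
    (j : Fin k) : t j ≤ ‖Δ‖ := by
  -- Keep the `L` leading singular directions and the `j`-th trailing one: `L + 1` directions in
  -- which `H` stretches by at least `t j`.
  let g : Fin L ⊕ Unit → Fin L ⊕ Fin k := Sum.map id fun _ => j
  have hg : Function.Injective g := by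
    rintro (a | a) (b | b) h <;> simp_all [g]
  have hW' : (W.submatrix id g)ᴴ * W.submatrix id g = 1 := by
    have : (W.submatrix id g)ᴴ * W.submatrix id g = (Wᴴ * W).submatrix g g := by
      ext; simp [Matrix.mul_apply]
    rw [this, hW, Matrix.submatrix_one _ hg]
  have hZ' : (Z.submatrix id g)ᴴ * Z.submatrix id g = 1 := by
    have : (Z.submatrix id g)ᴴ * Z.submatrix id g = (Zᴴ * Z).submatrix g g := by
      ext; simp [Matrix.mul_apply]
    rw [this, hZ, Matrix.submatrix_one _ hg]
  let σ : Fin L ⊕ Unit → ℝ := fun x => Sum.elim s t (g x)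
  have hσ : ∀ x, t j ≤ σ x := by
    rintro (a | a)
    · exact hst a j
    · exact le_rfl
  have hHW : (P * R + Δ) * W.submatrix id g
      = Z.submatrix id g * Matrix.diagonal (fun x => (σ x : ℂ)) := by
    have h1 : (P * R + Δ) * W = Z * Matrix.diagonal (fun i => ((Sum.elim s t i : ℝ) : ℂ)) := by
      rw [hH, Matrix.mul_assoc, hW, Matrix.mul_one]
    have h2 : (P * R + Δ) * W.submatrix id g = ((P * R + Δ) * W).submatrix id g := by
      ext; simp [Matrix.mul_apply]
    rw [h2, h1]
    ext p q
    simp [σ]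
  -- By dimension, `R` kills a nonzero combination of these `L + 1` directions. On it `H` acts as
  -- `Δ`, so `Δ` must stretch by at least `t j`.
  obtain ⟨x, hx, hx0⟩ : ∃ x, (R * W.submatrix id g) *ᵥ x = 0 ∧ x ≠ 0 := by
    have hlt : Module.finrank ℂ (Fin L → ℂ) < Module.finrank ℂ (Fin L ⊕ Unit → ℂ) := by simp
    obtain ⟨x, hx, h0⟩ := Submodule.exists_mem_ne_zero_of_ne_bot
      (LinearMap.ker_ne_bot_of_finrank_lt (f := (R * W.submatrix id g).mulVecLin) hlt)
    exact ⟨x, hx, h0⟩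
  have hΔ : Δ *ᵥ (W.submatrix id g *ᵥ x) = Z.submatrix id g *ᵥ (fun i => (σ i : ℂ) * x i) := by
    have h3 : (fun i => (σ i : ℂ) * x i) = Matrix.diagonal (fun x => (σ x : ℂ)) *ᵥ x := by
      ext i; rw [Matrix.mulVec_diagonal]
    rw [h3, Matrix.mulVec_mulVec _ (Z.submatrix id g), ← hHW, Matrix.add_mul, Matrix.add_mulVec, Matrix.mul_assoc P,
      ← Matrix.mulVec_mulVec, hx, Matrix.mulVec_zero, zero_add, Matrix.mulVec_mulVec]
  have h4 : ‖WithLp.toLp 2 (Δ *ᵥ (W.submatrix id g *ᵥ x))‖ ≤ ‖Δ‖ * ‖WithLp.toLp 2 x‖ := by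
    rw [← norm_isometry_mulVec hW' x]
    exact Matrix.l2_opNorm_mulVec Δ (WithLp.toLp 2 (W.submatrix id g *ᵥ x))
  have h5 : t j * ‖WithLp.toLp 2 x‖ ≤ ‖WithLp.toLp 2 (fun i => (σ i : ℂ) * x i)‖ := by
    refine (sq_le_sq₀ (mul_nonneg (ht j) (norm_nonneg _)) (norm_nonneg _)).1 ?_
    rw [mul_pow, EuclideanSpace.norm_sq_eq, EuclideanSpace.norm_sq_eq, Finset.mul_sum]
    refine Finset.sum_le_sum fun i _ => ?_
    have : 0 ≤ σ i := (ht j).trans (hσ i)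
    simp only [norm_mul, Complex.norm_real, Real.norm_eq_abs, mul_pow, sq_abs]
    exact mul_le_mul_of_nonneg_right (pow_le_pow_left₀ (ht j) (hσ i) 2) (sq_nonneg _)
  rw [hΔ, norm_isometry_mulVec hZ'] at h4
  refine le_of_mul_le_mul_right (h5.trans h4) (norm_pos_iff.2 fun h => hx0 ?_)
  ext i
  exact congrArg (fun v : EuclideanSpace ℂ _ => v i) h

/-- The basis `U (Uᴴ H Y)` of the leading left singular subspace of `H = P R + Δ` agrees with
`H Y = P + Δ Y` up to the second order. -/
theorem norm_signal_basis_sub_le {L : ℕ} {P : Matrix m (Fin L) ℂ} {R : Matrix (Fin L) n ℂ}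
    {Δ : Matrix m n ℂ} {C : Matrix (Fin L) m ℂ} (hC : C * P = 1) {Y : Matrix n (Fin L) ℂ}
    {W : Matrix (Fin L) (Fin L) ℂ} (hY : Y = Rᴴ * W) (hRY : R * Y = 1)
    {U : Matrix m (Fin L) ℂ} (hU : IsLeadingLeftSingular (P * R + Δ) U) :
    ‖U * (Uᴴ * (P * R + Δ) * Y) - (P + Δ * Y)‖ ≤ 2 * ‖C‖ * ‖W‖ * ‖Δ‖ ^ 2 := by
  obtain ⟨k, s, Vs, Un, t, Vn, hZ, hW, hs, ht, hst, hH⟩ := hU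
  have htΔ : ∀ j, t j ≤ ‖Δ‖ := singularValue_le hZ hW ht hst
    (hH.trans (fromCols_mul_diagonal_mul U Un Vs Vn s t).symm)
  simp only [Matrix.conjTranspose_fromCols_eq_fromRows_conjTranspose,
    Matrix.fromRows_mul_fromCols, ← Matrix.fromBlocks_one, Matrix.fromBlocks_inj] at hZ hW
  obtain ⟨hUU, hUUn, hUnU, hUnUn⟩ := hZ
  obtain ⟨hVV, hVVn, hVnV, hVnVn⟩ := hW
  have e1 : Uᴴ * (P * R + Δ) = Matrix.diagonal (fun i => (s i : ℂ)) * Vsᴴ := by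
    rw [hH, Matrix.mul_add]
    simp only [← Matrix.mul_assoc, hUU, hUUn, Matrix.one_mul, Matrix.zero_mul, add_zero]
  have e2 : P + Δ * Y = (P * R + Δ) * Y := by
    rw [Matrix.add_mul, Matrix.mul_assoc, hRY, Matrix.mul_one]
  -- Projecting `H Y` onto the span of `U` removes exactly its noise-subspace part. The factors `t`
  -- and `Vnᴴ Y` of that part are both of order `‖Δ‖`.
  have e3 : U * (Uᴴ * (P * R + Δ) * Y) - (P + Δ * Y)
      = -(Un * Matrix.diagonal (fun j => (t j : ℂ)) * (Vnᴴ * Y)) := by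
    rw [e1, e2, hH, Matrix.add_mul]
    simp only [Matrix.mul_assoc]
    abel
  -- The left inverse `C` recovers `R Vn` from `H Vn = Un t`, hence its smallness. Since `Y = Rᴴ W`,
  -- the product `Vnᴴ Y = (R Vn)ᴴ W` is small too.
  have e4 : R * Vn = C * (Un * Matrix.diagonal (fun j => (t j : ℂ)) - Δ * Vn) := by
    have h1 : (P * R + Δ) * Vn = Un * Matrix.diagonal (fun j => (t j : ℂ)) := by
      rw [hH, Matrix.add_mul]
      simp only [Matrix.mul_assoc, hVVn, hVnVn, Matrix.mul_zero, Matrix.mul_one, zero_add]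
    rw [← h1, Matrix.add_mul, add_sub_cancel_right, Matrix.mul_assoc, ← Matrix.mul_assoc C, hC,
      Matrix.one_mul]
  have hD : ‖Matrix.diagonal (fun j => (t j : ℂ))‖ ≤ ‖Δ‖ := by
    rw [Matrix.l2_opNorm_diagonal]
    refine (pi_norm_le_iff_of_nonneg (norm_nonneg _)).2 fun j => ?_
    rw [Complex.norm_real, Real.norm_of_nonneg (ht j)]
    exact htΔ j
  have hUn := norm_isometry_le hUnUn
  have hVn := norm_isometry_le hVnVn
  have hUD : ‖Un * Matrix.diagonal (fun j => (t j : ℂ))‖ ≤ ‖Δ‖ :=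
    (Matrix.l2_opNorm_mul _ _).trans
      ((mul_le_mul hUn hD (norm_nonneg _) zero_le_one).trans_eq (one_mul _))
  have hRV : ‖R * Vn‖ ≤ ‖C‖ * (2 * ‖Δ‖) := by
    rw [e4]
    refine (Matrix.l2_opNorm_mul _ _).trans (mul_le_mul_of_nonneg_left ?_ (norm_nonneg _))
    have : ‖Δ * Vn‖ ≤ ‖Δ‖ := (Matrix.l2_opNorm_mul _ _).trans
      (mul_le_of_le_one_right (norm_nonneg _) hVn)
    linarith [norm_sub_le (Un * Matrix.diagonal (fun j => (t j : ℂ))) (Δ * Vn)]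
  have hVY : ‖Vnᴴ * Y‖ ≤ ‖C‖ * (2 * ‖Δ‖) * ‖W‖ := by
    have : Vnᴴ * Y = (R * Vn)ᴴ * W := by
      rw [hY, Matrix.conjTranspose_mul, Matrix.mul_assoc]
    rw [this]
    refine (Matrix.l2_opNorm_mul _ _).trans ?_
    rw [Matrix.l2_opNorm_conjTranspose]
    exact mul_le_mul_of_nonneg_right hRV (norm_nonneg _)
  rw [e3, norm_neg]
  calc _ ≤ ‖Δ‖ * (‖C‖ * (2 * ‖Δ‖) * ‖W‖) :=
        (Matrix.l2_opNorm_mul _ _).trans (mul_le_mul hUD hVY (norm_nonneg _) (norm_nonneg _))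
    _ = _ := by ring

end SignalSubspace

/-! ### Asymptotic calculus of matrices -/

section Asymptotic

open Filter Topology Asymptotics
open scoped Matrix.Norms.L2Operator

variable {α : Type*} {l : Filter α} {u v : α → ℝ}
variable {m n p : Type*} [Fintype m] [Fintype n] [Fintype p] [DecidableEq m] [DecidableEq n]
  [DecidableEq p]

theorem isBigO_matrix_mul {A : α → Matrix m n ℂ} {B : α → Matrix n p ℂ} (hA : A =O[l] u)
    (hB : B =O[l] v) : (fun a => A a * B a) =O[l] fun a => u a * v a :=
  (IsBigO.of_bound 1 (Eventually.of_forall fun a => by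
    rw [one_mul, norm_mul, norm_norm, norm_norm]; exact Matrix.l2_opNorm_mul _ _)).trans
    (hA.norm_left.mul hB.norm_left)

theorem isLittleO_matrix_mul_left {A : α → Matrix m n ℂ} {B : α → Matrix n p ℂ} (hA : A =o[l] u)
    (hB : B =O[l] v) : (fun a => A a * B a) =o[l] fun a => u a * v a :=
  (IsBigO.of_bound 1 (Eventually.of_forall fun a => by
    rw [one_mul, norm_mul, norm_norm, norm_norm]; exact Matrix.l2_opNorm_mul _ _)).trans_isLittleO
    (hA.norm_left.mul_isBigO hB.norm_left)

theorem isLittleO_matrix_mul_right {A : α → Matrix m n ℂ} {B : α → Matrix n p ℂ} (hA : A =O[l] u)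
    (hB : B =o[l] v) : (fun a => A a * B a) =o[l] fun a => u a * v a :=
  (IsBigO.of_bound 1 (Eventually.of_forall fun a => by
    rw [one_mul, norm_mul, norm_norm, norm_norm]; exact Matrix.l2_opNorm_mul _ _)).trans_isLittleO
    (hA.norm_left.mul_isLittleO hB.norm_left)

theorem isBigO_const_matrix_mul (C : Matrix m n ℂ) {B : α → Matrix n p ℂ} (hB : B =O[l] u) :
    (fun a => C * B a) =O[l] u := by
  simpa using isBigO_matrix_mul (isBigO_const_const C (one_ne_zero (α := ℝ)) l) hB

theorem isBigO_matrix_mul_const {B : α → Matrix m n ℂ} (hB : B =O[l] u) (C : Matrix n p ℂ) :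
    (fun a => B a * C) =O[l] u := by
  simpa using isBigO_matrix_mul hB (isBigO_const_const C (one_ne_zero (α := ℝ)) l)

theorem isLittleO_const_matrix_mul (C : Matrix m n ℂ) {B : α → Matrix n p ℂ} (hB : B =o[l] u) :
    (fun a => C * B a) =o[l] u := by
  simpa using isLittleO_matrix_mul_right (isBigO_const_const C (one_ne_zero (α := ℝ)) l) hB

theorem isLittleO_matrix_mul_const {B : α → Matrix m n ℂ} (hB : B =o[l] u) (C : Matrix n p ℂ) :
    (fun a => B a * C) =o[l] u := by
  simpa using isLittleO_matrix_mul_left hB (isBigO_const_const C (one_ne_zero (α := ℝ)) l)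

theorem isBigO_entry (A : α → Matrix m n ℂ) (i : m) (j : n) : (fun a => A a i j) =O[l] A :=
  ((Matrix.entryLinearMap ℂ ℂ i j).toContinuousLinearMap).isBigO_comp A l

theorem tendsto_of_sub_isBigO {A : α → Matrix m n ℂ} {A₀ : Matrix m n ℂ}
    (h : (fun a => A a - A₀) =O[l] u) (hu : Tendsto u l (𝓝 0)) : Tendsto A l (𝓝 A₀) := by
  have := (h.trans_tendsto hu).add_const A₀
  simpa using this

theorem isLittleO_of_isBigO_sq {E : Type*} [NormedAddCommGroup E] {f : α → E}
    (h : f =O[l] fun a => u a ^ 2) (hu : Tendsto u l (𝓝 0)) : f =o[l] u := by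
  have h1 : (fun a => u a ^ 2) =o[l] u := by
    have := ((isLittleO_one_iff ℝ).2 hu).mul_isBigO (isBigO_refl u l)
    simpa [sq] using this
  exact h.trans_isLittleO h1

/-- First-order expansion of the least-squares solution of the shift equation. -/
theorem shift_solution_expansion {r : Type*} [Fintype r] [DecidableEq r] {L : ℕ}
    {J₁ J₂ : Matrix r m ℂ} {P : Matrix m (Fin L) ℂ} {Φ : Matrix (Fin L) (Fin L) ℂ}
    (hJ : J₂ * P = J₁ * P * Φ) (hP : IsUnit ((J₁ * P)ᴴ * (J₁ * P)))
    {X D : α → Matrix m (Fin L) ℂ} (hu : Tendsto u l (𝓝 0)) (hD : D =O[l] u)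
    (hX : (fun a => X a - (P + D a)) =o[l] u) :
    (fun a => pinv (J₁ * X a) * (J₂ * X a) - Φ - pinv (J₁ * P) * (J₂ * D a - J₁ * D a * Φ))
      =o[l] u := by
  have hXP : (fun a => X a - P) =O[l] u := by
    refine (hX.isBigO.add hD).congr_left fun a => ?_
    abel
  have hXt : Tendsto X l (𝓝 P) := tendsto_of_sub_isBigO hXP hu
  have hJX : Tendsto (fun a => J₁ * X a) l (𝓝 (J₁ * P)) := tendsto_matrix_mul tendsto_const_nhds hXt
  have hpinv := tendsto_pinv hJX hP
  have hp0 : (fun a => pinv (J₁ * X a) - pinv (J₁ * P)) =o[l] fun _ => (1 : ℝ) := by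
    rw [isLittleO_one_iff]
    simpa using hpinv.sub_const (pinv (J₁ * P))
  have hR : (fun a => J₂ * (X a - (P + D a)) - J₁ * (X a - (P + D a)) * Φ) =o[l] u :=
    (isLittleO_const_matrix_mul _ hX).sub
      (isLittleO_matrix_mul_const (isLittleO_const_matrix_mul _ hX) _)
  have hT : (fun a => J₂ * D a - J₁ * D a * Φ) =O[l] u :=
    (isBigO_const_matrix_mul _ hD).sub (isBigO_matrix_mul_const (isBigO_const_matrix_mul _ hD) _)
  -- `Γ - Φ = (J₁X)† (J₂X - J₁XΦ)`, and the second factor vanishes at `X = P`. Being of order `u`,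
  -- it allows `(J₁X)†` to be replaced by its limit; no derivative of the pseudoinverse is needed.
  have h1 : (fun a => (pinv (J₁ * X a) - pinv (J₁ * P)) * (J₂ * X a - J₁ * X a * Φ)
      + pinv (J₁ * P) * (J₂ * (X a - (P + D a)) - J₁ * (X a - (P + D a)) * Φ)) =o[l] u := by
    refine IsLittleO.add ?_ (isLittleO_const_matrix_mul _ hR)
    have h2 : (fun a => J₂ * X a - J₁ * X a * Φ) =O[l] u := by
      refine (hR.isBigO.add hT).congr_left fun a => ?_
      simp only [Matrix.mul_sub, Matrix.mul_add, Matrix.sub_mul, Matrix.add_mul, hJ]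
      abel
    simpa using isLittleO_matrix_mul_left hp0 h2
  refine h1.congr' ?_ EventuallyEq.rfl
  filter_upwards [eventually_isUnit_gram hJX hP] with a ha
  have h3 := pinv_mul_self ha
  have h4 : pinv (J₁ * X a) * (J₂ * X a - J₁ * X a * Φ) = pinv (J₁ * X a) * (J₂ * X a) - Φ := by
    rw [Matrix.mul_sub, ← Matrix.mul_assoc _ _ Φ, h3, Matrix.one_mul]
  rw [Matrix.sub_mul, h4]
  simp only [Matrix.mul_sub, Matrix.mul_add, Matrix.sub_mul, Matrix.add_mul, hJ]
  abel

end Asymptotic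

/-! ### Perturbation of a diagonal matrix with distinct entries -/

section Eigen

open Filter Topology Asymptotics
open scoped Matrix.Norms.L2Operator

variable {α : Type*} {l : Filter α} {u : α → ℝ} {n : Type*} [Fintype n] [DecidableEq n]

/-- The diagonal part of a matrix. -/
def diagPart (n : Type*) [Fintype n] [DecidableEq n] : Matrix n n ℂ →L[ℂ] Matrix n n ℂ :=
  ((Matrix.diagonalLinearMap n ℂ ℂ).comp (Matrix.diagLinearMap n ℂ ℂ)).toContinuousLinearMap

theorem diagPart_apply (Z : Matrix n n ℂ) : diagPart n Z = Matrix.diagonal Z.diag := rfl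

/-- `K` together with the defect of `(1 + off-diagonal part of Z, diagonal part of Z)` as an
eigenvalue decomposition of `K`. -/
def eigDefect (n : Type*) [Fintype n] [DecidableEq n] (q : Matrix n n ℂ × Matrix n n ℂ) :
    Matrix n n ℂ × Matrix n n ℂ :=
  (q.1, q.1 * (1 + (q.2 - diagPart n q.2)) - (1 + (q.2 - diagPart n q.2)) * diagPart n q.2)

/-- The derivative of `eigDefect` at `(K, K)`, for a diagonal `K`. -/
def eigDefectDeriv (K : Matrix n n ℂ) :
    Matrix n n ℂ × Matrix n n ℂ →L[ℂ] Matrix n n ℂ × Matrix n n ℂ :=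
  let A := ContinuousLinearMap.fst ℂ (Matrix n n ℂ) (Matrix n n ℂ)
  let B := ContinuousLinearMap.snd ℂ (Matrix n n ℂ) (Matrix n n ℂ)
  let O := B - (diagPart n).comp B
  A.prod (A + (K • O - MulOpposite.op K • O) - (diagPart n).comp B)

theorem eigDefectDeriv_apply (K A B : Matrix n n ℂ) :
    eigDefectDeriv K (A, B) = (A, A + (K * (B - diagPart n B) - (B - diagPart n B) * K)
      - diagPart n B) := rfl

theorem hasStrictFDerivAt_eigDefect (k : n → ℂ) :
    HasStrictFDerivAt (eigDefect n) (eigDefectDeriv (Matrix.diagonal k))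
      (Matrix.diagonal k, Matrix.diagonal k) := by
  have hA : HasStrictFDerivAt (fun q : Matrix n n ℂ × Matrix n n ℂ => q.1) _
    (Matrix.diagonal k, Matrix.diagonal k) := hasStrictFDerivAt_fst (𝕜 := ℂ)
  have hB : HasStrictFDerivAt (fun q : Matrix n n ℂ × Matrix n n ℂ => q.2) _
    (Matrix.diagonal k, Matrix.diagonal k) := hasStrictFDerivAt_snd (𝕜 := ℂ)
  have hdB := (diagPart n).hasStrictFDerivAt.comp _ hB
  have hO := (hB.sub hdB).const_add (1 : Matrix n n ℂ)
  have := hA.prodMk ((hA.mul' hO).sub (hO.mul' hdB))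
  refine this.congr_fderiv ?_
  refine ContinuousLinearMap.ext fun q => ?_
  obtain ⟨A, B⟩ := q
  rw [eigDefectDeriv_apply]
  refine Prod.ext rfl ?_
  have hd : diagPart n (Matrix.diagonal k) = Matrix.diagonal k := by
    rw [diagPart_apply, Matrix.diag_diagonal]
  change Matrix.diagonal k * (B - diagPart n B)
      + A * (1 + (Matrix.diagonal k - diagPart n (Matrix.diagonal k)))
      - ((1 + (Matrix.diagonal k - diagPart n (Matrix.diagonal k))) * diagPart n B
        + (B - diagPart n B) * diagPart n (Matrix.diagonal k))
    = A + (Matrix.diagonal k * (B - diagPart n B) - (B - diagPart n B) * Matrix.diagonal k)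
      - diagPart n B
  rw [hd, sub_self, add_zero, Matrix.mul_one, Matrix.one_mul]
  abel

/-- Off the diagonal the derivative multiplies `B i j` by `k i - k j`; on the diagonal it is `-B i
i`. Distinct entries therefore make it invertible, as the inverse function theorem requires. -/
theorem eigDefectDeriv_injective {k : n → ℂ} (hk : Function.Injective k) :
    Function.Injective (eigDefectDeriv (Matrix.diagonal k)) := by
  rw [injective_iff_map_eq_zero]
  rintro ⟨A, B⟩ h
  rw [eigDefectDeriv_apply, Prod.mk_eq_zero] at h
  obtain ⟨rfl, h⟩ := h
  refine Prod.mk_eq_zero.2 ⟨rfl, ?_⟩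
  ext i j
  have hij := congrFun (congrFun h i) j
  rcases eq_or_ne i j with rfl | hne
  · simpa [diagPart_apply] using hij
  · have h1 : (k i - k j) * B i j = 0 := by
      simpa [diagPart_apply, hne, mul_comm (B i j), sub_mul] using hij
    simpa [sub_ne_zero.2 (hk.ne hne)] using h1

/-- A small perturbation of a diagonal matrix with distinct entries is diagonalized by a small
perturbation of the identity. -/
theorem exists_eigenbasis {k : n → ℂ} (hk : Function.Injective k) {K : α → Matrix n n ℂ}
    (hu : Tendsto u l (𝓝 0)) (hK : (fun a => K a - Matrix.diagonal k) =O[l] u) :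
    ∃ (E : α → Matrix n n ℂ) (μ : α → n → ℂ), (fun a => E a - 1) =O[l] u ∧
      ∀ᶠ a in l, K a * E a = E a * Matrix.diagonal (μ a) ∧ Function.Injective (μ a) := by
  let e := (LinearEquiv.ofInjectiveEndo (eigDefectDeriv (Matrix.diagonal k)).toLinearMap
    (eigDefectDeriv_injective hk)).toContinuousLinearEquiv
  have hd : HasStrictFDerivAt (eigDefect n)
      (e : Matrix n n ℂ × Matrix n n ℂ →L[ℂ] Matrix n n ℂ × Matrix n n ℂ)
      (Matrix.diagonal k, Matrix.diagonal k) :=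
    (hasStrictFDerivAt_eigDefect k).congr_fderiv (ContinuousLinearMap.ext fun q => rfl)
  have h0 : eigDefect n (Matrix.diagonal k, Matrix.diagonal k) = (Matrix.diagonal k, 0) := by
    simp [eigDefect, diagPart_apply]
  let φ := hd.localInverse
  have hφ0 : φ (Matrix.diagonal k, 0) = (Matrix.diagonal k, Matrix.diagonal k) := by
    rw [← h0]; exact hd.localInverse_apply_image
  have hφ := hd.to_localInverse.hasFDerivAt.isBigO_sub
  have hφr := hd.eventually_right_inverse
  rw [h0] at hφ hφr
  have hKt : Tendsto (fun a => (K a, (0 : Matrix n n ℂ))) l (𝓝 (Matrix.diagonal k, 0)) :=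
    (tendsto_of_sub_isBigO hK hu).prodMk_nhds tendsto_const_nhds
  have hZ : (fun a => (φ (K a, 0)).2 - Matrix.diagonal k) =O[l] u := by
    have h1 := hφ.comp_tendsto hKt
    have h2 : (fun a => (K a, (0 : Matrix n n ℂ)) - (Matrix.diagonal k, 0)) =O[l] u := by
      simpa using hK.prod_left (isBigO_zero u l)
    have h3 := h1.trans h2
    have h4 : (fun a => (φ (K a, 0)).2 - Matrix.diagonal k) =O[l]
        fun a => φ (K a, 0) - φ (Matrix.diagonal k, 0) := by
      refine IsBigO.of_bound 1 (Eventually.of_forall fun a => ?_)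
      rw [hφ0, one_mul]
      exact norm_snd_le (φ (K a, 0) - (Matrix.diagonal k, Matrix.diagonal k))
    exact h4.trans h3
  have hZt := tendsto_of_sub_isBigO hZ hu
  -- A single matrix `Z` encodes the decomposition: its off-diagonal part is the eigenvector
  -- correction, its diagonal the eigenvalues. Unit diagonal in `E` fixes the scaling freedom.
  refine ⟨fun a => 1 + ((φ (K a, 0)).2 - diagPart n (φ (K a, 0)).2),
    fun a => ((φ (K a, 0)).2).diag, ?_, ?_⟩
  · have h1 := hZ.sub (((diagPart n).isBigO_comp _ l).trans hZ)
    refine h1.congr_left fun a => ?_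
    rw [map_sub, diagPart_apply (Matrix.diagonal k), Matrix.diag_diagonal, add_sub_cancel_left]
    abel
  · have hinj : ∀ᶠ a in l, ∀ i j, i ≠ j → ((φ (K a, 0)).2).diag i ≠ ((φ (K a, 0)).2).diag j := by
      refine eventually_all.2 fun i => eventually_all.2 fun j => ?_
      by_cases hij : i = j
      · exact Eventually.of_forall fun a h => absurd hij h
      have ht : ∀ i, Tendsto (fun a => ((φ (K a, 0)).2).diag i) l (𝓝 (k i)) := fun i => by
        simpa using tendsto_pi_nhds.1 (tendsto_pi_nhds.1 hZt i) i
      have := ((ht i).sub (ht j)).eventually_ne (sub_ne_zero.2 (hk.ne hij))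
      exact this.mono fun a ha _ => sub_ne_zero.1 ha
    filter_upwards [hKt.eventually hφr, hinj] with a ha hi
    refine ⟨?_, fun i j hij => by_contra fun h => hi i j h hij⟩
    have h1 : (φ (K a, 0)).1 = K a := congrArg Prod.fst ha
    have h2 : (eigDefect n (φ (K a, 0))).2 = 0 := congrArg Prod.snd ha
    rw [eigDefect, h1] at h2
    exact sub_eq_zero.1 h2

/-- Conjugation of a nearly diagonal matrix by a perturbation of the identity does not change the
diagonal in the first order. -/
theorem diag_conj_expansion {φ : n → ℂ} {E Γ : α → Matrix n n ℂ} (hu : Tendsto u l (𝓝 0))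
    (hE : (fun a => E a - 1) =O[l] u) (hΓ : (fun a => Γ a - Matrix.diagonal φ) =O[l] u) (i : n) :
    (fun a => ((E a)⁻¹ * Γ a * E a) i i - Γ a i i) =o[l] u := by
  have hEt : Tendsto E l (𝓝 1) := tendsto_of_sub_isBigO hE hu
  have hu1 := eventually_isUnit hEt isUnit_one
  have hinv : (fun a => (E a)⁻¹) =O[l] fun _ => (1 : ℝ) :=
    (tendsto_matrix_inv hEt isUnit_one).isBigO_one ℝ
  have hinv1 : (fun a => (E a)⁻¹ * (E a - 1)) =O[l] u := by
    simpa using isBigO_matrix_mul hinv hE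
  have hC : (fun a => Matrix.diagonal φ * (E a - 1) - (E a - 1) * Matrix.diagonal φ) =O[l] u :=
    (isBigO_const_matrix_mul _ hE).sub (isBigO_matrix_mul_const hE _)
  have h1 : (fun a => (E a)⁻¹ * ((Γ a - Matrix.diagonal φ) * (E a - 1)
      - (E a - 1) * (Γ a - Matrix.diagonal φ))
      - (E a)⁻¹ * (E a - 1) *
        (Matrix.diagonal φ * (E a - 1) - (E a - 1) * Matrix.diagonal φ)) =O[l]
      fun a => u a ^ 2 := by
    refine IsBigO.sub ?_ ?_
    · simpa [sq] using isBigO_matrix_mul hinv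
        ((isBigO_matrix_mul hΓ hE).sub (isBigO_matrix_mul hE hΓ))
    · simpa [sq] using isBigO_matrix_mul hinv1 hC
  refine (isLittleO_of_isBigO_sq ((isBigO_entry _ i i).trans h1) hu).congr' ?_ EventuallyEq.rfl
  filter_upwards [hu1] with a ha
  have hd := (Matrix.isUnit_iff_isUnit_det _).1 ha
  have e1 : (E a)⁻¹ * Γ a * E a - Γ a = (E a)⁻¹ * (Γ a * (E a - 1) - (E a - 1) * Γ a) := by
    have : (E a)⁻¹ * (E a * Γ a) = Γ a := by
      rw [← Matrix.mul_assoc, Matrix.nonsing_inv_mul _ hd, Matrix.one_mul]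
    simp only [Matrix.mul_sub, Matrix.sub_mul, this, Matrix.mul_one, Matrix.one_mul,
      Matrix.mul_assoc]
    abel
  have e2 : (E a)⁻¹ * (E a - 1) = 1 - (E a)⁻¹ := by
    rw [Matrix.mul_sub, Matrix.nonsing_inv_mul _ hd, Matrix.mul_one]
  -- The first-order term is isolated as the commutator of `diagonal φ` with `E - 1`, whose diagonal
  -- is zero; the other terms are quadratic.
  have e3 : (E a)⁻¹ * Γ a * E a - Γ a
      = (E a)⁻¹ * ((Γ a - Matrix.diagonal φ) * (E a - 1) - (E a - 1) * (Γ a - Matrix.diagonal φ))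
        - (E a)⁻¹ * (E a - 1) *
          (Matrix.diagonal φ * (E a - 1) - (E a - 1) * Matrix.diagonal φ)
        + (Matrix.diagonal φ * (E a - 1) - (E a - 1) * Matrix.diagonal φ) := by
    rw [e1, e2]
    noncomm_ring
  have e4 := congrFun (congrFun e3 i) i
  rw [Matrix.sub_apply, Matrix.add_apply] at e4
  rw [e4]
  simp [mul_comm]

/-- All diagonalizing matrices of a matrix with distinct eigenvalues induce, up to a
permutation, the same diagonals. -/
theorem exists_perm_diag_conj {K E₀ E : Matrix n n ℂ} {μ : n → ℂ} (hμ : Function.Injective μ)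
    (hE₀ : IsUnit E₀) (hK : K * E₀ = E₀ * Matrix.diagonal μ) (hE : IsUnit E)
    (hD : (E⁻¹ * K * E).IsDiag) :
    ∃ σ : Equiv.Perm n, ∀ (Γ : Matrix n n ℂ) (i : n),
      (E⁻¹ * Γ * E) (σ i) (σ i) = (E₀⁻¹ * Γ * E₀) i i := by
  have hd₀ := (Matrix.isUnit_iff_isUnit_det _).1 hE₀
  have hd := (Matrix.isUnit_iff_isUnit_det _).1 hE
  -- `W` intertwines two diagonal matrices, so `W i j ≠ 0` forces `μ i = ν j`. As `μ` is injective,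
  -- a column has at most one nonzero entry; as `W` is invertible, a row has at least one. Thus `W`
  -- is a permutation matrix up to scaling, and conjugation by it only permutes diagonals.
  set W := E₀⁻¹ * E with hW
  set ν := (E⁻¹ * K * E).diag with hν
  have hKE : K * E = E * Matrix.diagonal ν := by
    rw [hν, hD.diagonal_diag, Matrix.mul_assoc, ← Matrix.mul_assoc, Matrix.mul_nonsing_inv _ hd,
      Matrix.one_mul]
  have hEW : E = E₀ * W := by
    rw [hW, ← Matrix.mul_assoc, Matrix.mul_nonsing_inv _ hd₀, Matrix.one_mul]
  have hμW : Matrix.diagonal μ * W = W * Matrix.diagonal ν := by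
    calc Matrix.diagonal μ * W = E₀⁻¹ * (E₀ * Matrix.diagonal μ) * W := by
          rw [← Matrix.mul_assoc E₀⁻¹, Matrix.nonsing_inv_mul _ hd₀, Matrix.one_mul]
      _ = E₀⁻¹ * (K * E) := by rw [← hK, hEW]; simp only [Matrix.mul_assoc]
      _ = _ := by rw [hKE, ← Matrix.mul_assoc]
  have hent : ∀ i j, W i j ≠ 0 → μ i = ν j := fun i j h => by
    have := congrFun (congrFun hμW i) j
    rw [Matrix.diagonal_mul, Matrix.mul_diagonal, mul_comm] at this
    exact mul_left_cancel₀ h this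
  have hWu : IsUnit W := (Matrix.isUnit_nonsing_inv_iff.2 hE₀).mul hE
  have hrow : ∀ i, ∃ j, W i j ≠ 0 := fun i => by
    by_contra! h
    have h1 : (W * W⁻¹) i i = 0 := by simp [Matrix.mul_apply, h]
    rw [Matrix.mul_nonsing_inv _ ((Matrix.isUnit_iff_isUnit_det _).1 hWu)] at h1
    simp at h1
  choose s hs using hrow
  have hsi : Function.Injective s := fun i j hij =>
    hμ ((hent i _ (hs i)).trans (hij ▸ (hent j _ (hs j)).symm))
  refine ⟨Equiv.ofBijective s (Finite.injective_iff_bijective.1 hsi), fun Γ i => ?_⟩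
  obtain ⟨σ, hσ⟩ : ∃ σ : Equiv.Perm n, ∀ i, σ i = s i :=
    ⟨Equiv.ofBijective s (Finite.injective_iff_bijective.1 hsi), fun _ => rfl⟩
  rw [Equiv.ofBijective_apply]
  have hz : ∀ i j, i ≠ j → W i (s j) = 0 := fun i j hij => by
    by_contra h
    exact hij (hμ ((hent _ _ h).trans (hent _ _ (hs j)).symm))
  have hz' : ∀ i j, j ≠ s i → W i j = 0 := fun i j hij => by
    rw [← σ.apply_symm_apply j, hσ]
    refine hz _ _ fun h => hij ?_
    rw [h, ← hσ, σ.apply_symm_apply]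
  have hWN : W * (E⁻¹ * Γ * E) = E₀⁻¹ * Γ * E₀ * W := by
    have h1 : E * (E⁻¹ * Γ * E) = Γ * E := by
      rw [Matrix.mul_assoc, ← Matrix.mul_assoc, Matrix.mul_nonsing_inv _ hd, Matrix.one_mul]
    rw [hW, Matrix.mul_assoc, h1, ← hW, Matrix.mul_assoc _ E₀, ← hEW, Matrix.mul_assoc]
  have h2 := congrFun (congrFun hWN i) (s i)
  rw [Matrix.mul_apply, Matrix.mul_apply,
    Finset.sum_eq_single (s i) (fun j _ hj => by rw [hz' i j hj, zero_mul]) (by simp),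
    Finset.sum_eq_single i (fun j _ hj => by rw [hz j i hj, mul_zero]) (by simp), mul_comm] at h2
  exact mul_right_cancel₀ (hs i) h2

end Eigen

namespace System

variable (S : System) {L : ℕ}

/-! ### Structure of the noiseless channel -/

section Structure

theorem vandermonde_apply (m : ℕ) (ω : Fin L → ℝ) (i : Fin m) (l : Fin L) :
    vandermonde m ω i l = Complex.exp (Complex.I * (ω l : ℂ)) ^ (i : ℕ) := by
  rw [← Complex.exp_nat_mul, vandermonde, Matrix.of_apply]
  ring_nf

theorem matP_apply (ω : Fin L → Fin 5 → ℝ) (q : S.SIdx) (l : Fin L) :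
    S.matP ω q l = (∏ n, S.modeB ω n (q.1 n) l)
      * Complex.exp (Complex.I * (ω l 4 : ℂ)) ^ (q.2 : ℕ) := by
  rw [matP, khatriRao, Matrix.of_apply, vandermonde_apply]

theorem matB_apply (ω : Fin L → Fin 5 → ℝ) (q : S.Idx) (l : Fin L) :
    S.matB ω q l = (∏ n, S.modeB ω n (q.1 n) l)
      * Complex.exp (Complex.I * (ω l 4 : ℂ)) ^ (q.2 : ℕ) := by
  rw [matB, khatriRao, Matrix.of_apply, vandermonde_apply]

/-- Spatial smoothing as a linear map. -/
def smoothL : (S.Idx → ℂ) →L[ℂ] Matrix S.SIdx (Fin S.L5) ℂ :=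
  LinearMap.toContinuousLinearMap
    { toFun := S.smooth
      map_add' := fun _ _ => rfl
      map_smul' := fun _ _ => rfl }

theorem smoothL_apply (d : S.Idx → ℂ) : S.smoothL d = S.smooth d := rfl

theorem smooth_add (h d : S.Idx → ℂ) : S.smooth (h + d) = S.smooth h + S.smooth d := rfl

/-- Smoothing puts the sample at `k + ℓ` into entry `(k, ℓ)`, and an exponential at `k + ℓ` splits
into a factor for `P` and one for `G`. -/
theorem smooth_channel (η : Fin L → Fin 5 → ℝ) (γ : Fin L → ℂ) :
    S.smooth (S.channel η γ) = S.matP (fun l => S.angFreq (η l))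
      * (Matrix.diagonal γ * (S.matG fun l => S.angFreq (η l))ᵀ) := by
  ext q ℓ
  rw [smooth, Matrix.of_apply, channel, Matrix.mulVec, dotProduct, Matrix.mul_apply]
  refine Finset.sum_congr rfl fun l _ => ?_
  rw [matB_apply, matP_apply, Matrix.diagonal_mul, Matrix.transpose_apply, matG, vandermonde_apply]
  ring

theorem shift_matP_freq (ω : Fin L → Fin 5 → ℝ) :
    S.J2Freq * S.matP ω = S.J1Freq * S.matP ω
      * Matrix.diagonal (fun l => Complex.exp (Complex.I * (ω l 4 : ℂ))) := by
  ext p l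
  have hK := p.2.2
  have h1 : (S.J1Freq * S.matP ω) p l = S.matP ω (p.1, ⟨p.2, by omega⟩) l := by
    rw [Matrix.mul_apply, Finset.sum_eq_single (p.1, ⟨p.2, by omega⟩)]
    · simp [J1Freq, embedFreq, selFirst]
    · rintro ⟨b, c⟩ - hne
      simp only [J1Freq, embedFreq, selFirst, Matrix.of_apply]
      split_ifs with h2 h3
      · exact absurd (Prod.ext h2.symm (Fin.ext h3)) hne
      all_goals simp
    · simp
  have h2 : (S.J2Freq * S.matP ω) p l = S.matP ω (p.1, ⟨p.2 + 1, by omega⟩) l := by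
    rw [Matrix.mul_apply, Finset.sum_eq_single (p.1, ⟨p.2 + 1, by omega⟩)]
    · simp [J2Freq, embedFreq, selLast]
    · rintro ⟨b, c⟩ - hne
      simp only [J2Freq, embedFreq, selLast, Matrix.of_apply]
      split_ifs with h2 h3
      · exact absurd (Prod.ext h2.symm (Fin.ext h3)) hne
      all_goals simp
    · simp
  rw [Matrix.mul_diagonal, h1, h2, matP_apply, matP_apply]
  ring

/-- An operator in one mode acts only on that factor of the Khatri–Rao product; this reduces the
shift equation for `P` to the one for `modeB`. -/
theorem embedBeam_mul_matP (n : Fin 4) (X : Matrix (Fin (S.N n)) (Fin (S.N n)) ℂ)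
    (ω : Fin L → Fin 5 → ℝ) (q : S.SIdx) (l : Fin L) :
    (S.embedBeam n X * S.matP ω) q l = (X * S.modeB ω n) (q.1 n) l
      * ((∏ m ∈ Finset.univ.erase n, S.modeB ω m (q.1 m) l)
        * Complex.exp (Complex.I * (ω l 4 : ℂ)) ^ (q.2 : ℕ)) := by
  rw [Matrix.mul_apply, Matrix.mul_apply, Finset.sum_mul]
  have hinj : Function.Injective fun i : Fin (S.N n) =>
      ((Function.update q.1 n i, q.2) : S.SIdx) := fun i j h => by
    have := congrFun (congrArg Prod.fst h) n
    simpa using this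
  rw [← Finset.sum_subset (Finset.subset_univ
    (Finset.univ.map ⟨_, hinj⟩)), Finset.sum_map]
  · refine Finset.sum_congr rfl fun i _ => ?_
    simp only [Function.Embedding.coeFn_mk]
    rw [matP_apply, ← Finset.mul_prod_erase _ _ (Finset.mem_univ n)]
    have h1 : ∏ m ∈ Finset.univ.erase n, S.modeB ω m (Function.update q.1 n i m) l
        = ∏ m ∈ Finset.univ.erase n, S.modeB ω m (q.1 m) l :=
      Finset.prod_congr rfl fun m hm => by
        rw [Function.update_of_ne (Finset.ne_of_mem_erase hm)]
    have h2 : S.embedBeam n X q (Function.update q.1 n i, q.2) = X (q.1 n) i := by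
      rw [embedBeam, Matrix.of_apply, if_pos]
      · exact congrArg (X (q.1 n)) (Function.update_self n i q.1)
      exact ⟨fun m hm => (Function.update_of_ne hm i q.1).symm, rfl⟩
    have h3 : S.modeB ω n (Function.update q.1 n i n) l = S.modeB ω n i l := by
      rw [Function.update_self]
    rw [h1, h2, h3]
    ring
  · intro p _ hp
    rw [embedBeam, Matrix.of_apply, if_neg, zero_mul]
    rintro ⟨h1, h2⟩
    refine hp (Finset.mem_map.2 ⟨p.1 n, Finset.mem_univ _, ?_⟩)
    refine Prod.ext (funext fun m => ?_) h2
    by_cases hm : m = n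
    · subst hm; simp
    · simp [Function.update_of_ne hm, h1 m hm]

/-- Each column of `modeB` is `∑ t_m z^m`. Shift invariance means `Fᴴ t_{m+1} = t_m`, so `Fᴴ` acts
as multiplication by `z` up to boundary terms, and `Q` annihilates those. -/
theorem shift_modeB (hS : S.ShiftInvariant) (ω : Fin L → Fin 5 → ℝ) (n : Fin 4) :
    S.Q n * (S.F n)ᴴ * S.modeB ω n = S.Q n * S.modeB ω n
      * Matrix.diagonal (fun l => Complex.exp (Complex.I * (ω l n.castSucc : ℂ))) := by
  ext i l
  set z := Complex.exp (Complex.I * (ω l n.castSucc : ℂ)) with hz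
  rw [Matrix.mul_diagonal]
  have hcol : ∀ (X : Matrix (Fin (S.N n)) (Fin (S.N n)) ℂ),
      (X * S.modeB ω n) i l = ∑ m : Fin (S.M n), (X *ᵥ S.t n m) i * z ^ (m : ℕ) := fun X => by
    rw [modeB, ← Matrix.mul_assoc, Matrix.mul_apply]
    refine Finset.sum_congr rfl fun m _ => ?_
    rw [vandermonde_apply, ← hz]
    rfl
  rw [hcol, hcol]
  have hshift : ∀ m : ℕ, ∀ h : m + 1 < S.M n,
      (S.F n)ᴴ *ᵥ S.t n ⟨m + 1, h⟩ = S.t n ⟨m, by omega⟩ := fun m h => by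
    ext j
    have h1 := congrFun (congrFun (hS.shift n) ⟨m, by omega⟩) j
    rw [Matrix.mul_apply, Finset.sum_eq_single ⟨m, by omega⟩
      (fun b _ hb => by
        rw [selFirst, Matrix.of_apply, if_neg (fun h => hb (Fin.ext h)), zero_mul]) (by simp),
      Matrix.mul_assoc, Matrix.mul_apply, Finset.sum_eq_single ⟨m + 1, h⟩
      (fun b _ hb => by
        rw [selLast, Matrix.of_apply, if_neg (fun h => hb (Fin.ext h)), zero_mul]) (by simp)] at h1
    simp only [selFirst, selLast, Matrix.of_apply, if_true, one_mul] at h1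
    rw [t, Matrix.conjTranspose_apply, h1, Matrix.mul_apply, Matrix.mulVec, dotProduct,
      star_sum]
    refine Finset.sum_congr rfl fun x _ => ?_
    rw [t, Matrix.conjTranspose_apply, Matrix.conjTranspose_apply, star_mul', mul_comm]
  obtain hM | ⟨M, hM⟩ : S.M n = 0 ∨ ∃ M, S.M n = M + 1 := by
    cases S.M n <;> simp
  · have : IsEmpty (Fin (S.M n)) := by rw [hM]; infer_instance
    simp
  have e : ∀ f : ℕ → ℂ, ∑ m : Fin (S.M n), f m = ∑ m ∈ Finset.range (M + 1), f m := fun f => by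
    rw [Fin.sum_univ_eq_sum_range, hM]
  -- Extension by zero permits splitting off the first term of one sum and the last of the other,
  -- and shifting the index.
  let a : ℕ → ℂ := fun m => if h : m < S.M n then (S.Q n *ᵥ S.t n ⟨m, h⟩) i else 0
  let b : ℕ → ℂ := fun m =>
    if h : m < S.M n then ((S.Q n * (S.F n)ᴴ) *ᵥ S.t n ⟨m, h⟩) i else 0
  have ha : ∑ m : Fin (S.M n), (S.Q n *ᵥ S.t n m) i * z ^ (m : ℕ)
      = ∑ m ∈ Finset.range (M + 1), a m * z ^ m := by
    rw [← e]; exact Finset.sum_congr rfl fun m _ => by simp [a]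
  have hb : ∑ m : Fin (S.M n), ((S.Q n * (S.F n)ᴴ) *ᵥ S.t n m) i * z ^ (m : ℕ)
      = ∑ m ∈ Finset.range (M + 1), b m * z ^ m := by
    rw [← e]; exact Finset.sum_congr rfl fun m _ => by simp [b]
  rw [ha, hb, Finset.sum_range_succ', Finset.sum_range_succ]
  have hb0 : b 0 = 0 := by
    have h0 : 0 < S.M n := by omega
    simp only [b, h0, dif_pos, ← Matrix.mulVec_mulVec]
    rw [hS.Q_first n ⟨0, h0⟩ rfl, Pi.zero_apply]
  have haM : a M = 0 := by
    have h0 : M < S.M n := by omega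
    simp only [a, h0, dif_pos]
    rw [hS.Q_last n ⟨M, h0⟩ hM.symm, Pi.zero_apply]
  rw [hb0, haM, zero_mul, zero_mul, add_zero, add_zero, Finset.sum_mul]
  refine Finset.sum_congr rfl fun m hm => ?_
  have hm' := Finset.mem_range.1 hm
  have h1 : m + 1 < S.M n := by omega
  have h2 : m < S.M n := by omega
  have : b (m + 1) = a m := by
    simp only [a, b, h1, h2, dif_pos, ← Matrix.mulVec_mulVec]
    rw [hshift m h1]
  rw [this]
  ring

theorem shift_matP_beam (hS : S.ShiftInvariant) (ω : Fin L → Fin 5 → ℝ) (n : Fin 4) :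
    S.J2Beam n * S.matP ω = S.J1Beam n * S.matP ω
      * Matrix.diagonal (fun l => Complex.exp (Complex.I * (ω l n.castSucc : ℂ))) := by
  ext q l
  rw [Matrix.mul_diagonal, J1Beam, J2Beam, embedBeam_mul_matP, embedBeam_mul_matP,
    shift_modeB S hS, Matrix.mul_diagonal]
  ring

/-- In each mode, the algorithm solves a shift equation that `P` satisfies with the diagonal
matrix of the phasors. -/
theorem exists_selection (hS : S.ShiftInvariant) (η : Fin L → Fin 5 → ℝ)
    (hrank : ∀ n, (S.J1Beam n * S.matP (fun l => S.angFreq (η l))).rank = L)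
    (hrank5 : (S.J1Freq * S.matP (fun l => S.angFreq (η l))).rank = L) (n : Fin 5) :
    ∃ (r : Type) (_ : Fintype r) (_ : DecidableEq r) (J₁ J₂ : Matrix r S.SIdx ℂ),
      (∀ U : Matrix S.SIdx (Fin L) ℂ, S.Gam U n = pinv (J₁ * U) * (J₂ * U)) ∧
      (∀ l, S.lam η l n
        = S.lamOf J₁ J₂ (S.matP fun l => S.angFreq (η l)) (S.phasor (η l) n) l) ∧
      J₂ * S.matP (fun l => S.angFreq (η l)) = J₁ * S.matP (fun l => S.angFreq (η l))
        * Matrix.diagonal (fun l => S.phasor (η l) n) ∧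
      IsUnit ((J₁ * S.matP (fun l => S.angFreq (η l)))ᴴ
        * (J₁ * S.matP (fun l => S.angFreq (η l)))) := by
  refine Fin.lastCases ?_ (fun m => ?_) n
  · refine ⟨S.Beam × Fin (S.K5 - 1), inferInstance, inferInstance, S.J1Freq, S.J2Freq,
      fun U => ?_, fun l => ?_, S.shift_matP_freq _, ?_⟩
    · rw [Gam, Fin.lastCases_last]
    · rw [lam, Fin.lastCases_last]; rfl
    · exact isUnit_gram_of_rank (hrank5.trans (Fintype.card_fin L).symm)
  · refine ⟨S.SIdx, inferInstance, inferInstance, S.J1Beam m, S.J2Beam m,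
      fun U => ?_, fun l => ?_, S.shift_matP_beam hS _ m, ?_⟩
    · rw [Gam, Fin.lastCases_castSucc]
    · rw [lam, Fin.lastCases_castSucc]
    · exact isUnit_gram_of_rank ((hrank m).trans (Fintype.card_fin L).symm)

end Structure

/-! ### First-order expansion of the eigenvalues -/

section Eigenvalues

variable (η : Fin L → Fin 5 → ℝ) (γ : Fin L → ℂ)

/-- The right inverse `(Gᵀ)† Diag(γ)⁻¹` of `Diag(γ) Gᵀ`. -/
def rightInv : Matrix (Fin S.L5) (Fin L) ℂ :=
  pinv (S.matG fun l => S.angFreq (η l))ᵀ * Matrix.diagonal (fun l => (γ l)⁻¹)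

variable {γ}

theorem isUnit_cogram (hG : (S.matG fun l => S.angFreq (η l)).rank = L) :
    IsUnit ((S.matG fun l => S.angFreq (η l))ᵀ * (S.matG fun l => S.angFreq (η l))ᵀᴴ) := by
  have h := isUnit_gram_of_rank (hG.trans (Fintype.card_fin L).symm)
  have h2 := (Matrix.isUnit_transpose _).2 h
  rw [Matrix.transpose_mul] at h2
  exact h2

theorem mul_rightInv (hγ : ∀ l, γ l ≠ 0) (hG : (S.matG fun l => S.angFreq (η l)).rank = L) :
    Matrix.diagonal γ * (S.matG fun l => S.angFreq (η l))ᵀ * S.rightInv η γ = 1 := by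
  have hu := S.isUnit_cogram η hG
  rw [rightInv, pinv_of_isUnit_cogram hu, Matrix.mul_assoc, ← Matrix.mul_assoc _ᵀ,
    ← Matrix.mul_assoc _ᵀ, Matrix.mul_nonsing_inv _ ((Matrix.isUnit_iff_isUnit_det _).1 hu),
    Matrix.one_mul, Matrix.diagonal_mul_diagonal, ← Matrix.diagonal_one]
  congr 1
  ext l
  exact mul_inv_cancel₀ (hγ l)

/-- Membership of the columns in the range of `Rᴴ` is what makes the signal-subspace error quadratic
rather than linear. -/
theorem rightInv_eq (hγ : ∀ l, γ l ≠ 0) (hG : (S.matG fun l => S.angFreq (η l)).rank = L) :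
    ∃ W : Matrix (Fin L) (Fin L) ℂ, S.rightInv η γ = (Matrix.diagonal γ * (S.matG fun l => S.angFreq (η l))ᵀ)ᴴ * W := by
  have hu := S.isUnit_cogram η hG
  refine ⟨Matrix.diagonal (fun l => (star (γ l))⁻¹) *
    ((S.matG fun l => S.angFreq (η l))ᵀ * (S.matG fun l => S.angFreq (η l))ᵀᴴ)⁻¹
    * Matrix.diagonal (fun l => (γ l)⁻¹), ?_⟩
  have h1 : (Matrix.diagonal γ)ᴴ * Matrix.diagonal (fun l => (star (γ l))⁻¹) = 1 := by
    rw [Matrix.diagonal_conjTranspose, Matrix.diagonal_mul_diagonal, ← Matrix.diagonal_one]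
    congr 1
    ext l
    exact mul_inv_cancel₀ (star_ne_zero.2 (hγ l))
  rw [rightInv, pinv_of_isUnit_cogram hu, Matrix.conjTranspose_mul, Matrix.mul_assoc,
    Matrix.mul_assoc, Matrix.mul_assoc, ← Matrix.mul_assoc (Matrix.diagonal γ)ᴴ,
    h1, Matrix.one_mul]

/-- This connects the matrix perturbation with the closed form: on the `l`-th diagonal entry right
multiplication by `Φ` is the scalar `Φ_{l,n}`, leaving `λᴴ S(d) χ^* / γ_l`. The leading phasor on
the right cancels the conjugate phasor from `υ`. -/
theorem upsilon_pairing (n : Fin 5) (l : Fin L) (d : S.Idx → ℂ)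
    {r : Type} [Fintype r] [DecidableEq r] (J₁ J₂ : Matrix r S.SIdx ℂ)
    (hlam : S.lam η l n
      = S.lamOf J₁ J₂ (S.matP fun l => S.angFreq (η l)) (S.phasor (η l) n) l) :
    (pinv (J₁ * S.matP fun l => S.angFreq (η l)) * (J₂ * (S.smooth d * S.rightInv η γ)
      - J₁ * (S.smooth d * S.rightInv η γ) * Matrix.diagonal fun l => S.phasor (η l) n)) l l
      = S.phasor (η l) n * ∑ p, star (S.upsilon η γ l n p) * d p := by
  have hΦ : S.phasor (η l) n * star (S.phasor (η l) n) = 1 := by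
    rw [RCLike.star_def, Complex.mul_conj', phasor, mul_comm, Complex.norm_exp_ofReal_mul_I]
    simp
  set Y := S.smooth d * S.rightInv η γ with hY
  set C := pinv (J₁ * S.matP fun l => S.angFreq (η l)) with hC
  have h1 : (C * (J₂ * Y - J₁ * Y * Matrix.diagonal fun l => S.phasor (η l) n)) l l
      = (C * (J₂ - S.phasor (η l) n • J₁) * Y) l l := by
    have e1 : C * (J₂ * Y - J₁ * Y * Matrix.diagonal fun l => S.phasor (η l) n)
        = C * J₂ * Y - C * J₁ * Y * Matrix.diagonal fun l => S.phasor (η l) n := by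
      simp only [Matrix.mul_sub, Matrix.mul_assoc]
    have e2 : C * (J₂ - S.phasor (η l) n • J₁) * Y
        = C * J₂ * Y - S.phasor (η l) n • (C * J₁ * Y) := by
      simp only [Matrix.mul_sub, Matrix.sub_mul, Matrix.mul_smul, Matrix.smul_mul]
    rw [e1, e2, Matrix.sub_apply, Matrix.sub_apply, Matrix.mul_diagonal, Matrix.smul_apply,
      smul_eq_mul, mul_comm (S.phasor (η l) n)]
  have h2 : ∀ q, (C * (J₂ - S.phasor (η l) n • J₁)) l q = star (S.lam η l n q) := fun q => by
    rw [hlam, lamOf, star_star]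
  have h3 : ∀ q, Y q l = (∑ ℓ, S.smooth d q ℓ * star (S.chi η l ℓ)) * (γ l)⁻¹ := fun q => by
    rw [hY, rightInv, ← Matrix.mul_assoc, Matrix.mul_diagonal, Matrix.mul_apply]
    simp only [chi, star_star]
  -- Smoothing and blockwise convolution are adjoint: `(λ ∗ χ)ᴴ d = λᴴ S(d) χ^*`.
  have h4 : ∑ p, star (S.xi η l n p) * d p
      = ∑ q, star (S.lam η l n q) * ∑ ℓ, S.smooth d q ℓ * star (S.chi η l ℓ) := by
    rw [Fintype.sum_prod_type, Fintype.sum_prod_type]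
    refine Finset.sum_congr rfl fun b _ => ?_
    simp only [xi, star_sum, Finset.sum_mul, Finset.mul_sum]
    rw [Finset.sum_comm]
    refine Finset.sum_congr rfl fun k _ => ?_
    rw [Finset.sum_comm]
    refine Finset.sum_congr rfl fun ℓ _ => ?_
    have hlt : (k : ℕ) + ℓ < S.M5 := by
      have := S.size; have := k.2; have := ℓ.2; omega
    rw [Finset.sum_eq_single ⟨(k : ℕ) + ℓ, hlt⟩]
    · simp only [if_true, smooth, Matrix.of_apply, star_mul']
      ring
    · intro x _ hx
      rw [if_neg (fun h => hx (Fin.ext h.symm)), star_zero, zero_mul]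
    · simp
  rw [h1, Matrix.mul_apply]
  simp only [h2, h3, upsilon, Pi.smul_apply, smul_eq_mul, star_mul', star_div₀, star_star,
    mul_assoc]
  rw [← Finset.mul_sum, h4, div_eq_mul_inv, mul_assoc, ← mul_assoc, hΦ, one_mul, Finset.mul_sum]
  refine Finset.sum_congr rfl fun q _ => ?_
  ring

open Filter Topology Asymptotics
open scoped Matrix.Norms.L2Operator

variable {α : Type*} {f : Filter α}

/-- First-order expansion of the eigenvalues that the algorithm finds. -/
theorem eigenvalue_expansion (hS : S.ShiftInvariant) (hγ : ∀ l, γ l ≠ 0)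
    (hrank : ∀ n, (S.J1Beam n * S.matP (fun l => S.angFreq (η l))).rank = L)
    (hrank5 : (S.J1Freq * S.matP (fun l => S.angFreq (η l))).rank = L)
    (hG : (S.matG (fun l => S.angFreq (η l))).rank = L) {β : Fin 5 → ℂ}
    (hβ : Function.Injective (fun l : Fin L => ∑ n, β n * S.phasor (η l) n))
    {d : α → S.Idx → ℂ} (hd : Tendsto d f (𝓝 0)) {U : α → Matrix S.SIdx (Fin L) ℂ}
    (hU : ∀ a, IsLeadingLeftSingular (S.smooth (S.channel η γ + d a)) (U a)) :
    ∃ E : α → Matrix (Fin L) (Fin L) ℂ,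
      (∀ᶠ a in f, IsUnit (E a) ∧ ∃ μ : Fin L → ℂ, Function.Injective μ ∧
        (∑ n, β n • S.Gam (U a) n) * E a = E a * Matrix.diagonal μ) ∧
      ∀ l n, (fun a => ((E a)⁻¹ * S.Gam (U a) n * E a) l l - S.phasor (η l) n
        - S.phasor (η l) n * ∑ p, star (S.upsilon η γ l n p) * d a p)
          =o[f] fun a => ‖d a‖ := by
  choose r hr hr' J₁ J₂ hGam hlam hJ hgram using S.exists_selection hS η hrank hrank5
  set P := S.matP (fun l => S.angFreq (η l)) with hP
  set R := Matrix.diagonal γ * (S.matG fun l => S.angFreq (η l))ᵀ with hR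
  set Y := S.rightInv η γ with hY
  have hu : Tendsto (fun a => ‖d a‖) f (𝓝 0) := tendsto_norm_zero.comp hd
  have hΔ : (fun a => S.smooth (d a)) =O[f] fun a => ‖d a‖ :=
    ((S.smoothL).isBigO_comp d f).norm_right
  -- Only some left inverse of `P` is needed; any of the five modes would supply one.
  let C := pinv (J₁ 4 * P) * J₁ 4
  have hC : C * P = 1 := by rw [Matrix.mul_assoc]; exact pinv_mul_self (hgram 4)
  obtain ⟨W, hW⟩ := S.rightInv_eq η hγ hG
  have hRY : R * Y = 1 := S.mul_rightInv η hγ hG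
  have hsm : ∀ a, S.smooth (S.channel η γ + d a) = P * R + S.smooth (d a) := fun a => by
    rw [smooth_add, smooth_channel]
  let A : α → Matrix (Fin L) (Fin L) ℂ := fun a => (U a)ᴴ * (P * R + S.smooth (d a)) * Y
  let X : α → Matrix S.SIdx (Fin L) ℂ := fun a => U a * A a
  have hD : (fun a => S.smooth (d a) * Y) =O[f] fun a => ‖d a‖ := isBigO_matrix_mul_const hΔ Y
  have hX : (fun a => X a - (P + S.smooth (d a) * Y)) =o[f] fun a => ‖d a‖ := by
    refine isLittleO_of_isBigO_sq ?_ hu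
    have h1 : (fun a => X a - (P + S.smooth (d a) * Y)) =O[f] fun a => ‖S.smooth (d a)‖ ^ 2 := by
      refine IsBigO.of_bound (2 * ‖C‖ * ‖W‖) (Eventually.of_forall fun a => ?_)
      rw [norm_pow, norm_norm]
      exact norm_signal_basis_sub_le hC hW hRY (hsm a ▸ hU a)
    exact h1.trans (hΔ.norm_left.pow 2)
  have hXt : Tendsto X f (𝓝 P) := by
    refine tendsto_of_sub_isBigO ((hX.isBigO.add hD).congr_left fun a => ?_) hu
    abel
  have hA : ∀ᶠ a in f, IsUnit (A a) := by
    have h1 : Tendsto (fun a => C * X a) f (𝓝 1) := hC ▸ tendsto_matrix_mul tendsto_const_nhds hXt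
    filter_upwards [eventually_isUnit h1 isUnit_one] with a ha
    have h2 : C * X a = (C * U a) * A a := (Matrix.mul_assoc _ _ _).symm
    rw [h2, Matrix.isUnit_iff_isUnit_det, Matrix.det_mul] at ha
    exact (Matrix.isUnit_iff_isUnit_det _).2 (isUnit_of_mul_isUnit_right ha)
  have hexp : ∀ n, (fun a => S.Gam (X a) n - Matrix.diagonal (fun l => S.phasor (η l) n)
      - pinv (J₁ n * P) * (J₂ n * (S.smooth (d a) * Y) - J₁ n * (S.smooth (d a) * Y)
        * Matrix.diagonal (fun l => S.phasor (η l) n))) =o[f] fun a => ‖d a‖ := fun n => by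
    simp only [hGam]
    exact shift_solution_expansion (hJ n) (hgram n) hu hD hX
  have hΓ : ∀ n, (fun a => S.Gam (X a) n - Matrix.diagonal (fun l => S.phasor (η l) n))
      =O[f] fun a => ‖d a‖ := fun n => by
    have h1 : (fun a => pinv (J₁ n * P) * (J₂ n * (S.smooth (d a) * Y) -
        J₁ n * (S.smooth (d a) * Y) * Matrix.diagonal (fun l => S.phasor (η l) n)))
        =O[f] fun a => ‖d a‖ :=
      isBigO_const_matrix_mul _ ((isBigO_const_matrix_mul _ hD).sub
        (isBigO_matrix_mul_const (isBigO_const_matrix_mul _ hD) _))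
    refine ((hexp n).isBigO.add h1).congr_left fun a => ?_
    abel
  have hK : (fun a => ∑ n, β n • S.Gam (X a) n
      - Matrix.diagonal (fun l => ∑ n, β n * S.phasor (η l) n)) =O[f] fun a => ‖d a‖ := by
    refine (IsBigO.sum (s := Finset.univ) fun n _ => (hΓ n).const_smul_left (β n)).congr_left
      fun a => ?_
    have : Matrix.diagonal (fun l => ∑ n, β n * S.phasor (η l) n)
        = ∑ n, β n • Matrix.diagonal (fun l => S.phasor (η l) n) := by
      ext i j
      rw [Matrix.sum_apply]
      rcases eq_or_ne i j with rfl | h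
      · simp
      · simp [h]
    rw [this, ← Finset.sum_sub_distrib]
    simp [smul_sub]
  obtain ⟨E, μ, hE, hEμ⟩ := exists_eigenbasis hβ hu hK
  have hEt := eventually_isUnit (tendsto_of_sub_isBigO hE hu) isUnit_one
  -- `A` inherits the arbitrariness of `U` and need not converge. Its invertibility suffices: it is
  -- absorbed into the eigenvector matrix `A E` and cancels from the diagonals.
  have hsim : ∀ᶠ a in f, ∀ n, S.Gam (U a) n = A a * S.Gam (X a) n * (A a)⁻¹ := by
    refine eventually_all.2 fun n => ?_
    filter_upwards [hA, eventually_isUnit_gram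
      (tendsto_matrix_mul (tendsto_const_nhds (x := J₁ n)) hXt) (hgram n)] with a ha hg
    have hAd := (Matrix.isUnit_iff_isUnit_det _).1 ha
    have hUX : U a = X a * (A a)⁻¹ := by
      rw [Matrix.mul_assoc, Matrix.mul_nonsing_inv _ hAd, Matrix.mul_one]
    rw [hUX, hGam, hGam, ← Matrix.mul_assoc (J₁ n), ← Matrix.mul_assoc (J₂ n),
      pinv_mul_isUnit hg (Matrix.isUnit_nonsing_inv_iff.2 ha), Matrix.nonsing_inv_nonsing_inv _ hAd]
    simp only [Matrix.mul_assoc]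
  refine ⟨fun a => A a * E a, ?_, fun l n => ?_⟩
  · filter_upwards [hA, hEt, hEμ, hsim] with a ha he hm hs
    have hAd := (Matrix.isUnit_iff_isUnit_det _).1 ha
    refine ⟨ha.mul he, μ a, hm.2, ?_⟩
    have h1 : ∑ n, β n • S.Gam (U a) n = A a * (∑ n, β n • S.Gam (X a) n) * (A a)⁻¹ := by
      simp only [hs, Finset.mul_sum, Finset.sum_mul, Matrix.mul_smul, Matrix.smul_mul]
    rw [h1, Matrix.mul_assoc, ← Matrix.mul_assoc (A a)⁻¹, Matrix.nonsing_inv_mul _ hAd,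
      Matrix.one_mul, Matrix.mul_assoc, hm.1, Matrix.mul_assoc (A a) (E a)]
  · have h1 := diag_conj_expansion hu hE (hΓ n) l
    have h2 := (isBigO_entry _ l l).trans_isLittleO (hexp n)
    refine (h1.add h2).congr' ?_ EventuallyEq.rfl
    filter_upwards [hA, hsim] with a ha hs
    have hAd := (Matrix.isUnit_iff_isUnit_det _).1 ha
    have h3 : (A a * E a)⁻¹ * S.Gam (U a) n * (A a * E a) = (E a)⁻¹ * S.Gam (X a) n * E a := by
      rw [hs, Matrix.mul_inv_rev]
      have : (A a)⁻¹ * A a = 1 := Matrix.nonsing_inv_mul _ hAd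
      calc _ = (E a)⁻¹ * ((A a)⁻¹ * A a) * S.Gam (X a) n * ((A a)⁻¹ * A a) * E a := by
            simp only [Matrix.mul_assoc]
        _ = _ := by rw [this, Matrix.mul_one, Matrix.mul_one]
    rw [h3, Matrix.sub_apply, Matrix.sub_apply, Matrix.diagonal_apply_eq,
      S.upsilon_pairing η n l (d a) (J₁ n) (J₂ n) (hlam n l)]
    ring

end Eigenvalues

end System

/-! ### From eigenvalues to angular frequencies -/

open Filter Topology Asymptotics

/-- First-order expansion of the phase of a perturbed phasor. -/
theorem phase_expansion {α : Type*} {f : Filter α} {u : α → ℝ} (hu : Tendsto u f (𝓝 0)) {φ : ℝ}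
    {z w : α → ℂ} (hw : w =O[f] u)
    (hz : (fun a => z a - Complex.exp (Complex.I * φ) - Complex.exp (Complex.I * φ) * w a)
      =o[f] u) :
    ∃ ω : α → ℝ, (fun a => ω a - φ - (w a).im) =o[f] u ∧
      ∀ᶠ a in f, Complex.exp (Complex.I * (ω a : ℂ))
        = Complex.exp (Complex.I * ((Complex.log (z a)).im : ℂ)) := by
  set Φ := Complex.exp (Complex.I * φ) with hΦ
  have hΦ0 : Φ ≠ 0 := Complex.exp_ne_zero _
  have hΦ1 : ‖Φ‖ = 1 := by rw [hΦ, mul_comm, Complex.norm_exp_ofReal_mul_I]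
  -- Dividing by `Φ` moves the logarithm to `1`, away from its branch cut. The algorithm's own
  -- logarithm may jump by `2π`, so agreement is claimed only after exponentiation.
  let y : α → ℂ := fun a => z a / Φ
  have hy : (fun a => y a - 1 - w a) =o[f] u := by
    refine (hz.const_mul_left Φ⁻¹).congr_left fun a => ?_
    simp only [y]
    field_simp
  have hy1 : (fun a => y a - 1) =O[f] u := (hy.isBigO.add hw).congr_left fun a => by ring
  have hyt : Tendsto y f (𝓝 1) := by
    simpa using (hy1.trans_tendsto hu).add_const 1
  have hlog : (fun a => Complex.log (y a) - (y a - 1)) =o[f] u := by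
    have h1 := (Complex.hasStrictDerivAt_log (x := 1) (by simp)).hasDerivAt.isLittleO
    refine ((h1.comp_tendsto hyt).trans_isBigO hy1).congr_left fun a => ?_
    simp
  have hlog' : (fun a => Complex.log (y a) - w a) =o[f] u :=
    (hlog.add hy).congr_left fun a => by ring
  refine ⟨fun a => φ + (Complex.log (y a)).im, ?_, ?_⟩
  · have h2 := (Complex.imCLM.isBigO_comp (fun a => Complex.log (y a) - w a) f).trans_isLittleO hlog'
    refine h2.congr_left fun a => ?_
    simp
  · filter_upwards [hyt.eventually_ne one_ne_zero] with a ha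
    have hza : z a = Φ * y a := by simp only [y]; field_simp
    have hz0 : z a ≠ 0 := hza ▸ mul_ne_zero hΦ0 ha
    have e1 := Complex.norm_mul_exp_arg_mul_I (z a)
    have e2 := Complex.norm_mul_exp_arg_mul_I (y a)
    have hn : ‖z a‖ = ‖y a‖ := by rw [hza, norm_mul, hΦ1, one_mul]
    have hy0 : (‖y a‖ : ℂ) ≠ 0 := by simpa using ha
    rw [Complex.log_im, Complex.log_im, Complex.ofReal_add, mul_add, Complex.exp_add, ← hΦ,
      mul_comm Complex.I, mul_comm Complex.I]
    refine mul_left_cancel₀ hy0 ?_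
    rw [mul_left_comm, e2, ← hza, ← hn, e1]

namespace System

variable (S : System) {L : ℕ}

/-! ### The angles and the delay as functions of the angular frequencies -/

section Parameters

/-- The Jacobian of the angular frequencies. -/
def angFreqDeriv (x : Fin 5 → ℝ) : (Fin 5 → ℝ) →ₗ[ℝ] (Fin 5 → ℝ) where
  toFun v := ![Real.pi * (Real.cos (x 0) * v 0 * Real.sin (x 1)
      + Real.sin (x 0) * (Real.cos (x 1) * v 1)), -(Real.pi * (Real.sin (x 1) * v 1)),
    Real.pi * (Real.cos (x 2) * v 2 * Real.sin (x 3) + Real.sin (x 2) * (Real.cos (x 3) * v 3)),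
    -(Real.pi * (Real.sin (x 3) * v 3)), -(2 * Real.pi * S.Δf * v 4)]
  map_add' v w := by ext i; fin_cases i <;> simp <;> ring
  map_smul' c v := by ext i; fin_cases i <;> simp <;> ring

/-- The inverse of the Jacobian of the angular frequencies. -/
def angFreqDerivInv (x : Fin 5 → ℝ) : (Fin 5 → ℝ) →ₗ[ℝ] (Fin 5 → ℝ) where
  toFun w := ![1 / (Real.pi * Real.cos (x 0) * Real.sin (x 1)) * w 0
      + Real.sin (x 0) * Real.cos (x 1) / (Real.pi * Real.cos (x 0) * Real.sin (x 1) ^ 2) * w 1,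
    -(1 / (Real.pi * Real.sin (x 1)) * w 1),
    1 / (Real.pi * Real.cos (x 2) * Real.sin (x 3)) * w 2
      + Real.sin (x 2) * Real.cos (x 3) / (Real.pi * Real.cos (x 2) * Real.sin (x 3) ^ 2) * w 3,
    -(1 / (Real.pi * Real.sin (x 3)) * w 3), -(1 / (2 * Real.pi * S.Δf) * w 4)]
  map_add' v w := by ext i; fin_cases i <;> simp <;> ring
  map_smul' c v := by ext i; fin_cases i <;> simp <;> ring

variable {x : Fin 5 → ℝ}

/-- The Jacobian of the angular frequencies as an equivalence. -/
def angFreqEquiv (hΔf : 0 < S.Δf) (hT : Real.cos (x 0) ≠ 0 ∧ Real.sin (x 1) ≠ 0)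
    (hR : Real.cos (x 2) ≠ 0 ∧ Real.sin (x 3) ≠ 0) : (Fin 5 → ℝ) ≃L[ℝ] (Fin 5 → ℝ) :=
  (LinearEquiv.ofLinearMap (S.angFreqDeriv x) (S.angFreqDerivInv x)
    (by
      obtain ⟨h0, h1⟩ := hT
      obtain ⟨h2, h3⟩ := hR
      have hpi := Real.pi_ne_zero
      have hΔ := hΔf.ne'
      refine LinearMap.ext fun v => funext fun i => ?_
      fin_cases i <;> simp [angFreqDeriv, angFreqDerivInv] <;> field_simp <;> ring)
    (by
      obtain ⟨h0, h1⟩ := hT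
      obtain ⟨h2, h3⟩ := hR
      have hpi := Real.pi_ne_zero
      have hΔ := hΔf.ne'
      refine LinearMap.ext fun v => funext fun i => ?_
      fin_cases i <;> simp [angFreqDeriv, angFreqDerivInv] <;> field_simp <;> ring)).toContinuousLinearEquiv

theorem hasStrictFDerivAt_angFreq (hΔf : 0 < S.Δf) (hT : Real.cos (x 0) ≠ 0 ∧ Real.sin (x 1) ≠ 0)
    (hR : Real.cos (x 2) ≠ 0 ∧ Real.sin (x 3) ≠ 0) :
    HasStrictFDerivAt S.angFreq
      (S.angFreqEquiv hΔf hT hR : (Fin 5 → ℝ) →L[ℝ] (Fin 5 → ℝ)) x := by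
  have hc : ∀ i : Fin 5, HasStrictFDerivAt (fun y : Fin 5 → ℝ => y i)
      (ContinuousLinearMap.proj (R := ℝ) (φ := fun _ : Fin 5 => ℝ) i) x :=
    fun i => hasStrictFDerivAt_apply i x
  have hsin := fun i => (hc i).sin
  have hcos := fun i => (hc i).cos
  rw [hasStrictFDerivAt_pi']
  intro i
  fin_cases i
  · refine (((hsin 0).const_mul Real.pi).mul (hsin 1)).congr_fderiv ?_
    refine ContinuousLinearMap.ext fun v => ?_
    simp [angFreqEquiv, angFreqDeriv]
    ring
  · refine ((hcos 1).const_mul Real.pi).congr_fderiv ?_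
    refine ContinuousLinearMap.ext fun v => ?_
    simp [angFreqEquiv, angFreqDeriv]
  · refine (((hsin 2).const_mul Real.pi).mul (hsin 3)).congr_fderiv ?_
    refine ContinuousLinearMap.ext fun v => ?_
    simp [angFreqEquiv, angFreqDeriv]
    ring
  · refine ((hcos 3).const_mul Real.pi).congr_fderiv ?_
    refine ContinuousLinearMap.ext fun v => ?_
    simp [angFreqEquiv, angFreqDeriv]
  · refine ((hc 4).const_mul (2 * Real.pi * S.Δf)).neg.congr_fderiv ?_
    refine ContinuousLinearMap.ext fun v => ?_
    simp [angFreqEquiv, angFreqDeriv]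

/-- First-order expansion of the parameters with perturbed angular frequencies. -/
theorem param_expansion (hΔf : 0 < S.Δf) (hT : Real.cos (x 0) ≠ 0 ∧ Real.sin (x 1) ≠ 0)
    (hR : Real.cos (x 2) ≠ 0 ∧ Real.sin (x 3) ≠ 0) {α : Type*} {f : Filter α} {u : α → ℝ}
    (hu : Tendsto u f (𝓝 0)) {ω w : α → Fin 5 → ℝ} (hw : w =O[f] u)
    (hω : (fun a => ω a - S.angFreq x - w a) =o[f] u) :
    ∃ y : α → Fin 5 → ℝ, (fun a => y a - x - S.angFreqDerivInv x (w a)) =o[f] u ∧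
      Tendsto y f (𝓝 x) ∧ ∀ᶠ a in f, S.angFreq (y a) = ω a := by
  have hd := S.hasStrictFDerivAt_angFreq hΔf hT hR
  have hω1 : (fun a => ω a - S.angFreq x) =O[f] u :=
    (hω.isBigO.add hw).congr_left fun a => by abel
  have hωt : Tendsto ω f (𝓝 (S.angFreq x)) := by
    simpa using (hω1.trans_tendsto hu).add_const (S.angFreq x)
  let e := S.angFreqEquiv hΔf hT hR
  have h1 := (hd.to_localInverse.hasFDerivAt.isLittleO.comp_tendsto hωt).trans_isBigO hω1
  have h2 := ((e.symm : (Fin 5 → ℝ) →L[ℝ] (Fin 5 → ℝ)).isBigO_comp _ f).trans_isLittleO hω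
  have h0 : HasStrictFDerivAt.localInverse S.angFreq _ x hd (S.angFreq x) = x :=
    hd.localInverse_apply_image
  refine ⟨fun a => HasStrictFDerivAt.localInverse S.angFreq _ x hd (ω a), ?_, ?_, hωt.eventually hd.eventually_right_inverse⟩
  · refine (h1.add h2).congr_left fun a => ?_
    simp only [Function.comp_apply, h0, map_sub]
    have : S.angFreqDerivInv x (w a) = e.symm (w a) := rfl
    rw [this]
    simp only [ContinuousLinearEquiv.coe_coe, e]
    abel
  · have := hd.localInverse_continuousAt.tendsto.comp hωt
    rwa [h0] at this

end Parameters

/-! ### The gains -/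

section Gains

/-- An entry of `Tᴴ a(ω)` and its derivative in `ω`. -/
theorem hasDerivAt_beam {m k : ℕ} (T : Matrix (Fin m) (Fin k) ℂ) (i : Fin k) (ω : Fin L → ℝ)
    (l : Fin L) :
    HasDerivAt (fun t : ℝ => (Tᴴ * vandermonde m (fun _ : Fin L => t)) i l)
      (((breveT T)ᴴ * vandermonde m ω) i l) (ω l) := by
  simp only [Matrix.mul_apply]
  refine HasDerivAt.fun_sum fun j _ => ?_
  simp only [vandermonde, Matrix.of_apply]
  have h1 : HasDerivAt (fun t : ℝ => Complex.I * ((j : ℕ) : ℂ) * (t : ℂ))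
      (Complex.I * ((j : ℕ) : ℂ)) (ω l) := by
    simpa using (Complex.ofRealCLM.hasDerivAt (x := ω l)).const_mul (Complex.I * ((j : ℕ) : ℂ))
  refine (h1.cexp.const_mul (Tᴴ i j)).congr_deriv ?_
  simp [breveT, Matrix.diagonal_mul]
  ring

theorem matB_perm (ω : Fin L → Fin 5 → ℝ) (σ : Equiv.Perm (Fin L)) :
    S.matB (fun l => ω (σ l)) = (S.matB ω).submatrix id σ := rfl

/-- The gains are insensitive to the `2π` ambiguity of the estimated frequencies. -/
theorem matB_congr {ω ω' : Fin L → Fin 5 → ℝ}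
    (h : ∀ l n, Complex.exp (Complex.I * (ω l n : ℂ)) = Complex.exp (Complex.I * (ω' l n : ℂ))) :
    S.matB ω = S.matB ω' := by
  ext p l
  have h1 : ∀ n i, S.modeB ω n i l = S.modeB ω' n i l := fun n i => by
    simp only [modeB, Matrix.mul_apply, vandermonde_apply, h]
  rw [matB_apply, matB_apply, h]
  simp only [h1]

/-- The product rule over the five factors. A column of `B` depends on its own path alone, so a
constant family of frequencies suffices for an entry. -/
theorem hasFDerivAt_matB (ω : Fin L → Fin 5 → ℝ) (p : S.Idx) (l : Fin L) :
    HasFDerivAt (fun w : Fin 5 → ℝ => S.matB (fun _ : Fin L => w) p l)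
      (∑ n, (ContinuousLinearMap.proj (R := ℝ) n : (Fin 5 → ℝ) →L[ℝ] ℝ).smulRight
        (S.breveB ω n p l)) (ω l) := by
  have hproj : ∀ n : Fin 5, HasFDerivAt (fun w : Fin 5 → ℝ => w n)
      (ContinuousLinearMap.proj (R := ℝ) (φ := fun _ : Fin 5 => ℝ) n) (ω l) :=
    fun n => hasFDerivAt_apply n (ω l)
  have hg : ∀ n : Fin 4, HasFDerivAt
      (fun w : Fin 5 → ℝ => S.modeB (fun _ : Fin L => w) n (p.1 n) l)
      ((ContinuousLinearMap.proj (R := ℝ) (φ := fun _ : Fin 5 => ℝ) n.castSucc).smulRight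
        (((breveT (S.T n))ᴴ * vandermonde (S.M n) (fun l => ω l n.castSucc)) (p.1 n) l))
      (ω l) := fun n => by
    have h := HasFDerivAt.comp (ω l)
      (g := fun t : ℝ => ((S.T n)ᴴ * vandermonde (S.M n) (fun _ : Fin L => t)) (p.1 n) l)
      (hasDerivAt_beam (S.T n) (p.1 n) (fun l => ω l n.castSucc) l).hasFDerivAt
      (hproj n.castSucc)
    exact h.congr_fderiv (ContinuousLinearMap.ext fun v => by simp)
  have hg5 : HasFDerivAt
      (fun w : Fin 5 → ℝ => vandermonde S.M5 (fun _ : Fin L => w 4) p.2 l)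
      ((ContinuousLinearMap.proj (R := ℝ) (φ := fun _ : Fin 5 => ℝ) 4).smulRight
        (((breveT (1 : Matrix (Fin S.M5) (Fin S.M5) ℂ))ᴴ
          * vandermonde S.M5 (fun l => ω l 4)) p.2 l)) (ω l) := by
    have h := HasFDerivAt.comp (ω l)
      (g := fun t : ℝ => ((1 : Matrix (Fin S.M5) (Fin S.M5) ℂ)ᴴ
        * vandermonde S.M5 (fun _ : Fin L => t)) p.2 l)
      (hasDerivAt_beam (1 : Matrix (Fin S.M5) (Fin S.M5) ℂ) p.2 (fun l => ω l 4) l).hasFDerivAt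
      (hproj 4)
    simp only [Matrix.conjTranspose_one, Matrix.one_mul] at h
    exact h.congr_fderiv (ContinuousLinearMap.ext fun v => by simp)
  have hprod := HasFDerivAt.finsetProd (u := Finset.univ) fun n _ => hg n
  refine (hprod.mul hg5).congr_fderiv (ContinuousLinearMap.ext fun v => ?_)
  have hlast : S.breveB ω (Fin.last 4) p l = (∏ n, S.modeB ω n (p.1 n) l)
      * ((breveT (1 : Matrix (Fin S.M5) (Fin S.M5) ℂ))ᴴ
        * vandermonde S.M5 (fun l => ω l 4)) p.2 l := by
    rw [breveB, Fin.lastCases_last]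
    rfl
  have hcast : ∀ n : Fin 4, S.breveB ω n.castSucc p l
      = (∏ m ∈ Finset.univ.erase n, S.modeB ω m (p.1 m) l)
        * ((breveT (S.T n))ᴴ * vandermonde (S.M n) (fun l => ω l n.castSucc)) (p.1 n) l
        * vandermonde S.M5 (fun l => ω l 4) p.2 l := fun n => by
    rw [breveB, Fin.lastCases_castSucc, khatriRao, Matrix.of_apply,
      ← Finset.prod_erase_mul _ _ (Finset.mem_univ n), Function.update_self]
    congr 2
    exact Finset.prod_congr rfl fun m hm => by
      rw [Function.update_of_ne (Finset.ne_of_mem_erase hm)]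
  simp only [ContinuousLinearMap.smulRight_apply, ContinuousLinearMap.proj_apply,
    add_apply, smul_apply, sum_apply, smul_eq_mul, Complex.real_smul]
  rw [Fin.sum_univ_castSucc (n := 4), hlast]
  simp only [hcast]
  rw [add_comm, Finset.mul_sum]
  congr 1
  · refine Finset.sum_congr rfl fun n _ => ?_
    change vandermonde S.M5 (fun l => ω l 4) p.2 l
      * ((∏ m ∈ Finset.univ.erase n, S.modeB ω m (p.1 m) l) * _) = _
    ring
  · change (∏ m, S.modeB ω m (p.1 m) l) * _ = _
    rw [mul_left_comm]
    rfl

end Gains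

end System

/-! ### Imaginary parts of pairings -/

/-- The real-linear functional `d ↦ Im (κᴴ d)`. -/
def imPairing {ι : Type*} [Fintype ι] (κ : ι → ℂ) : (ι → ℂ) →L[ℝ] ℝ :=
  LinearMap.toContinuousLinearMap
    { toFun := fun d => (∑ p, star (κ p) * d p).im
      map_add' := fun d e => by
        simp only [Pi.add_apply, mul_add, Finset.sum_add_distrib, Complex.add_im]
      map_smul' := fun c d => by
        simp only [Pi.smul_apply, mul_smul_comm, ← Finset.smul_sum, Complex.smul_im,
          RingHom.id_apply] }

theorem imPairing_apply {ι : Type*} [Fintype ι] (κ d : ι → ℂ) :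
    imPairing κ d = (∑ p, star (κ p) * d p).im := rfl

theorem imPairing_add {ι : Type*} [Fintype ι] (κ κ' d : ι → ℂ) :
    imPairing (κ + κ') d = imPairing κ d + imPairing κ' d := by
  simp only [imPairing_apply, Pi.add_apply, star_add, add_mul, Finset.sum_add_distrib,
    Complex.add_im]

theorem imPairing_smul {ι : Type*} [Fintype ι] (c : ℝ) (κ d : ι → ℂ) :
    imPairing (c • κ) d = c * imPairing κ d := by
  simp only [imPairing_apply, Pi.smul_apply, star_smul, smul_mul_assoc, ← Finset.smul_sum,
    Complex.smul_im, star_trivial, smul_eq_mul]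

namespace System

variable (S : System) {L : ℕ} (η : Fin L → Fin 5 → ℝ) (γ : Fin L → ℂ)

/-! ### The first-order perturbation -/

/-- The first-order perturbation of the angles and the delays. -/
def paramPert (l : Fin L) (i : Fin 5) : (S.Idx → ℂ) →L[ℝ] ℝ :=
  -- The signs come from the derivative of cosine and from the negative sign in the delay frequency.
  -- `kappa` omits them, as they vanish on squaring.
  (![1, -1, 1, -1, -1] i : ℝ) • imPairing (S.kappa η γ l i)

theorem paramPert_apply (l : Fin L) (i : Fin 5) (d : S.Idx → ℂ) :
    S.paramPert η γ l i d
      = S.angFreqDerivInv (η l) (fun n => imPairing (S.upsilon η γ l n) d) i := by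
  rw [paramPert, smul_apply, smul_eq_mul]
  fin_cases i <;> simp [kappa, angFreqDerivInv, imPairing_add, imPairing_smul]

/-- The first-order perturbation of the gains. -/
def gainPert (l : Fin L) : (S.Idx → ℂ) →L[ℝ] ℂ :=
  LinearMap.toContinuousLinearMap
    { toFun := fun d => ∑ p, pinv (S.matB fun l => S.angFreq (η l)) l p * d p
        - ∑ n, ∑ k, S.Ups η γ n l k * (imPairing (S.upsilon η γ k n) d : ℂ)
      map_add' := fun d e => by
        simp only [Pi.add_apply, mul_add, Finset.sum_add_distrib, map_add, Complex.ofReal_add]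
        ring
      map_smul' := fun c d => by
        simp only [Pi.smul_apply, map_smul, RingHom.id_apply,
          smul_eq_mul, Complex.ofReal_mul, Complex.real_smul, mul_left_comm _ (c : ℂ),
          ← Finset.mul_sum, mul_sub] }

theorem gainPert_apply (l : Fin L) (d : S.Idx → ℂ) :
    S.gainPert η γ l d = ∑ p, pinv (S.matB fun l => S.angFreq (η l)) l p * d p
        - ∑ n, ∑ k, S.Ups η γ n l k * (imPairing (S.upsilon η γ k n) d : ℂ) := rfl

/-- `P` consists of rows of `B`, so a left inverse of `P` gives one of `B`. This uses `K5 ≤ M5`,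
hence `L5 ≥ 1`, which rank `L` of `G` guarantees only when `L > 0`. -/
theorem isUnit_gram_matB (hrank5 : (S.J1Freq * S.matP (fun l => S.angFreq (η l))).rank = L)
    (hG : (S.matG (fun l => S.angFreq (η l))).rank = L) :
    IsUnit ((S.matB fun l => S.angFreq (η l))ᴴ * S.matB fun l => S.angFreq (η l)) := by
  have hL : L ≤ S.L5 := by
    rw [← hG]
    exact (Matrix.rank_le_card_height _).trans_eq (Fintype.card_fin _)
  rcases Nat.eq_zero_or_pos L with rfl | hpos
  · exact isUnit_of_subsingleton _
  have hK : S.K5 ≤ S.M5 := by have := S.size; omega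
  have hP := pinv_mul_self (isUnit_gram_of_rank (hrank5.trans (Fintype.card_fin L).symm))
  rw [← Matrix.mul_assoc] at hP
  let g : S.SIdx → S.Idx := fun q => (q.1, Fin.castLE hK q.2)
  have hB : S.matP (fun l => S.angFreq (η l))
      = (1 : Matrix S.Idx S.Idx ℂ).submatrix g id * S.matB fun l => S.angFreq (η l) := by
    ext q l
    rw [Matrix.mul_apply]
    simp only [Matrix.submatrix_apply, Matrix.one_apply, id]
    rw [Finset.sum_eq_single (g q) (fun p _ hp => by rw [if_neg hp.symm, zero_mul]) (by simp),
      if_pos rfl, one_mul, matP_apply, matB_apply]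
    rfl
  rw [hB, ← Matrix.mul_assoc] at hP
  exact isUnit_gram_of_mul_eq_one hP

variable {α : Type*} {f : Filter α} {u : α → ℝ}

theorem tendsto_matB {ω₀ : Fin L → Fin 5 → ℝ} {ω : α → Fin L → Fin 5 → ℝ}
    (hω : ∀ l, Tendsto (fun a => ω a l) f (𝓝 (ω₀ l))) :
    Tendsto (fun a => S.matB (ω a)) f (𝓝 (S.matB ω₀)) := by
  refine tendsto_pi_nhds.2 fun p => tendsto_pi_nhds.2 fun k => ?_
  have h := (S.hasFDerivAt_matB ω₀ p k).continuousAt.tendsto.comp (hω k)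
  exact h

theorem matB_entry_expansion {ω₀ : Fin L → Fin 5 → ℝ} {ω w : α → Fin L → Fin 5 → ℝ} (k : Fin L)
    (p : S.Idx) (hωt : Tendsto (fun a => ω a k) f (𝓝 (ω₀ k)))
    (hω1 : (fun a => ω a k - ω₀ k) =O[f] u) (hω : (fun a => ω a k - ω₀ k - w a k) =o[f] u) :
    (fun a => S.matB (ω a) p k - S.matB ω₀ p k - ∑ n, (w a k n : ℂ) * S.breveB ω₀ n p k)
      =o[f] u := by
  have h1 := ((S.hasFDerivAt_matB ω₀ p k).isLittleO.comp_tendsto hωt).trans_isBigO hω1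
  set B' := ∑ n, (ContinuousLinearMap.proj (R := ℝ) n : (Fin 5 → ℝ) →L[ℝ] ℝ).smulRight
    (S.breveB ω₀ n p k) with hB'
  have h2 := (B'.isBigO_comp _ f).trans_isLittleO hω
  refine (h1.add h2).congr_left fun a => ?_
  have e : ∑ n, (w a k n : ℂ) * S.breveB ω₀ n p k = B' (w a k) := by
    simp only [hB', sum_apply, ContinuousLinearMap.smulRight_apply,
      ContinuousLinearMap.proj_apply, Complex.real_smul]
  have e2 : B' (ω a k - ω₀ k - w a k) = B' (ω a k - ω₀ k) - B' (w a k) := map_sub B' _ _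
  have e3 : S.matB (fun _ : Fin L => ω a k) p k = S.matB (ω a) p k := rfl
  have e4 : S.matB (fun _ : Fin L => ω₀ k) p k = S.matB ω₀ p k := rfl
  simp only [Function.comp_apply, e, e2, e3, e4]
  exact sub_add_sub_cancel _ _ _

/-- First-order expansion of the least-squares gains. -/
theorem gain_expansion {ω₀ : Fin L → Fin 5 → ℝ} (hB : IsUnit ((S.matB ω₀)ᴴ * S.matB ω₀))
    (hu : Tendsto u f (𝓝 0)) {d : α → S.Idx → ℂ} (hd : d =O[f] u)
    {ω w : α → Fin L → Fin 5 → ℝ} (hw : ∀ l, (fun a => w a l) =O[f] u)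
    (hω : ∀ l, (fun a => ω a l - ω₀ l - w a l) =o[f] u) (l : Fin L) :
    (fun a => (pinv (S.matB (ω a)) *ᵥ (S.matB ω₀ *ᵥ γ + d a)) l - γ l
      - (∑ p, pinv (S.matB ω₀) l p * d a p
        - ∑ n, ∑ k, (pinv (S.matB ω₀) * S.breveB ω₀ n * Matrix.diagonal γ) l k * (w a k n : ℂ)))
      =o[f] u := by
  have hω1 : ∀ l, (fun a => ω a l - ω₀ l) =O[f] u := fun l =>
    ((hω l).isBigO.add (hw l)).congr_left fun a => by abel
  have hωt : ∀ l, Tendsto (fun a => ω a l) f (𝓝 (ω₀ l)) := fun l => by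
    simpa using ((hω1 l).trans_tendsto hu).add_const (ω₀ l)
  have hent := fun p k => S.matB_entry_expansion k p (hωt k) (hω1 k) (hω k)
  have hBt := S.tendsto_matB hωt
  have hpt := tendsto_pinv hBt hB
  let v₀ : α → S.Idx → ℂ := fun a p => d a p - ∑ k, (∑ n, (w a k n : ℂ) * S.breveB ω₀ n p k) * γ k
  -- The input equals `B(ω) γ + v`, so the gain error is exactly `B(ω)† v`. Since `v` is of order
  -- `u`, the pseudoinverse may be frozen at `ω₀` and `v` replaced by its linear part `v₀`.
  let v : α → S.Idx → ℂ := fun a p => d a p - ∑ k, (S.matB (ω a) p k - S.matB ω₀ p k) * γ k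
  have hv₀ : ∀ p, (fun a => v₀ a p) =O[f] u := fun p => by
    refine (isBigO_pi.1 hd p).sub (IsBigO.fun_sum fun k _ => ?_)
    simp only [mul_comm _ (γ k)]
    refine IsBigO.const_mul_left (IsBigO.fun_sum fun n _ => ?_) _
    simp only [mul_comm _ (S.breveB ω₀ n p k)]
    refine IsBigO.const_mul_left ?_ _
    exact (Complex.ofRealCLM.isBigO_comp (fun a => w a k n) f).trans (isBigO_pi.1 (hw k) n)
  have hvv : ∀ p, (fun a => v a p - v₀ a p) =o[f] u := fun p => by
    have h1 : (fun a => ∑ k, (S.matB (ω a) p k - S.matB ω₀ p k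
      - ∑ n, (w a k n : ℂ) * S.breveB ω₀ n p k) * γ k) =o[f] u :=
      IsLittleO.fun_sum fun k _ => by
        simpa only [mul_comm _ (γ k)] using (hent p k).const_mul_left (γ k)
    refine h1.neg_left.congr_left fun a => ?_
    simp only [v, v₀, sub_mul, Finset.sum_sub_distrib]
    ring
  have hv : ∀ p, (fun a => v a p) =O[f] u := fun p =>
    ((hvv p).isBigO.add (hv₀ p)).congr_left fun a => by ring
  have hmain : (fun a => ∑ p, ((pinv (S.matB (ω a)) l p - pinv (S.matB ω₀) l p) * v a p
      + pinv (S.matB ω₀) l p * (v a p - v₀ a p))) =o[f] u := by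
    refine IsLittleO.fun_sum fun p _ => IsLittleO.add ?_ ((hvv p).const_mul_left _)
    have h1 : (fun a => pinv (S.matB (ω a)) l p - pinv (S.matB ω₀) l p)
        =o[f] fun _ => (1 : ℝ) := by
      rw [isLittleO_one_iff]
      simpa using (tendsto_pi_nhds.1 (tendsto_pi_nhds.1 hpt l) p).sub_const (pinv (S.matB ω₀) l p)
    simpa using h1.mul_isBigO (hv p)
  refine hmain.congr' ?_ EventuallyEq.rfl
  filter_upwards [eventually_isUnit_gram hBt hB] with a ha
  have e1 : S.matB ω₀ *ᵥ γ + d a = S.matB (ω a) *ᵥ γ + v a := by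
    ext p
    simp only [v, Pi.add_apply, Matrix.mulVec, dotProduct, sub_mul, Finset.sum_sub_distrib]
    ring
  have e2 : (pinv (S.matB (ω a)) *ᵥ (S.matB ω₀ *ᵥ γ + d a)) l
      = γ l + ∑ p, pinv (S.matB (ω a)) l p * v a p := by
    rw [e1, Matrix.mulVec_add, Matrix.mulVec_mulVec, pinv_mul_self ha, Matrix.one_mulVec]
    rfl
  have e3 : ∑ p, pinv (S.matB ω₀) l p * v₀ a p = ∑ p, pinv (S.matB ω₀) l p * d a p
      - ∑ n, ∑ k, (pinv (S.matB ω₀) * S.breveB ω₀ n * Matrix.diagonal γ) l k * (w a k n : ℂ) := by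
    have hU : ∀ n k, (pinv (S.matB ω₀) * S.breveB ω₀ n * Matrix.diagonal γ) l k * (w a k n : ℂ)
        = ∑ p, pinv (S.matB ω₀) l p * ((w a k n : ℂ) * S.breveB ω₀ n p k * γ k) := fun n k => by
      rw [Matrix.mul_diagonal, Matrix.mul_apply, Finset.sum_mul, Finset.sum_mul]
      exact Finset.sum_congr rfl fun p _ => by ring
    simp only [v₀, mul_sub, Finset.sum_sub_distrib, hU, Finset.mul_sum, Finset.sum_mul]
    congr 1
    exact (Finset.sum_comm.trans (Finset.sum_congr rfl fun k _ => Finset.sum_comm)).trans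
      Finset.sum_comm
  rw [e2, ← e3]
  simp only [sub_mul, mul_sub, Finset.sum_add_distrib, Finset.sum_sub_distrib]
  ring

variable {γ} in
/-- First-order expansion of the estimates, for any choice of the signal subspace. -/
theorem estimate_expansion (hS : S.ShiftInvariant) (hΔf : 0 < S.Δf) {D : Set (Fin 5 → ℝ)}
    (hD : IsOpen D) (hη : ∀ l, η l ∈ D) (hγ : ∀ l, γ l ≠ 0)
    (hT : ∀ l, Real.cos (η l 0) ≠ 0 ∧ Real.sin (η l 1) ≠ 0)
    (hR : ∀ l, Real.cos (η l 2) ≠ 0 ∧ Real.sin (η l 3) ≠ 0)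
    (hrank : ∀ n, (S.J1Beam n * S.matP (fun l => S.angFreq (η l))).rank = L)
    (hrank5 : (S.J1Freq * S.matP (fun l => S.angFreq (η l))).rank = L)
    (hG : (S.matG (fun l => S.angFreq (η l))).rank = L) {β : Fin 5 → ℂ}
    (hβ : Function.Injective (fun l : Fin L => ∑ n, β n * S.phasor (η l) n))
    {d : α → S.Idx → ℂ} (hd : Tendsto d f (𝓝 0)) {U : α → Matrix S.SIdx (Fin L) ℂ}
    (hU : ∀ a, IsLeadingLeftSingular (S.smooth (S.channel η γ + d a)) (U a)) :
    ∃ (E : α → Matrix (Fin L) (Fin L) ℂ) (ω y : α → Fin L → Fin 5 → ℝ),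
      (∀ᶠ a in f, IsUnit (E a) ∧ (∃ μ : Fin L → ℂ, Function.Injective μ ∧
          (∑ n, β n • S.Gam (U a) n) * E a = E a * Matrix.diagonal μ) ∧
        (∀ l n, Complex.exp (Complex.I * (ω a l n : ℂ)) = Complex.exp (Complex.I *
          ((Complex.log (((E a)⁻¹ * S.Gam (U a) n * E a) l l)).im : ℂ))) ∧
        (∀ l, y a l ∈ D ∧ S.angFreq (y a l) = ω a l) ∧
        IsUnit ((S.matB (ω a))ᴴ * S.matB (ω a))) ∧
      (∀ l i, (fun a => y a l i - η l i - S.paramPert η γ l i (d a)) =o[f] fun a => ‖d a‖) ∧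
      ∀ l, (fun a => (pinv (S.matB (ω a)) *ᵥ (S.channel η γ + d a)) l - γ l
        - S.gainPert η γ l (d a)) =o[f] fun a => ‖d a‖ := by
  have hu : Tendsto (fun a => ‖d a‖) f (𝓝 0) := tendsto_norm_zero.comp hd
  have hdO : d =O[f] fun a => ‖d a‖ := (isBigO_refl d f).norm_right
  obtain ⟨E, hE, hexp⟩ := S.eigenvalue_expansion η hS hγ hrank hrank5 hG hβ hd hU
  have hpair : ∀ l n, (fun a => ∑ p, star (S.upsilon η γ l n p) * d a p)
      =O[f] fun a => ‖d a‖ := fun l n =>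
    IsBigO.fun_sum fun p _ => (isBigO_pi.1 hdO p).const_mul_left _
  choose ω hω hωexp using fun l n => phase_expansion hu (hpair l n) (hexp l n)
  let w : α → Fin L → Fin 5 → ℝ := fun a l n => imPairing (S.upsilon η γ l n) (d a)
  have hw : ∀ l, (fun a => w a l) =O[f] fun a => ‖d a‖ := fun l =>
    isBigO_pi.2 fun n => ((imPairing (S.upsilon η γ l n)).isBigO_comp d f).norm_right
  have hωv : ∀ l, (fun a => (fun n => ω l n a) - S.angFreq (η l) - w a l)
      =o[f] fun a => ‖d a‖ := fun l => isLittleO_pi.2 fun n => hω l n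
  choose y hy hyt hyω using fun l => S.param_expansion hΔf (hT l) (hR l) hu (hw l) (hωv l)
  refine ⟨E, fun a l n => ω l n a, fun a l => y l a, ?_, fun l i => ?_, fun l => ?_⟩
  · have h1 := eventually_all.2 fun l => eventually_all.2 (hωexp l)
    have h2 := eventually_all.2 fun l => (hyt l).eventually (hD.mem_nhds (hη l))
    have hωt : ∀ l, Tendsto (fun a n => ω l n a) f (𝓝 (S.angFreq (η l))) := fun l => by
      have h3 := ((hωv l).isBigO.add (hw l)).trans_tendsto hu
      simpa using h3.add_const (S.angFreq (η l))
    filter_upwards [hE, h1, h2, eventually_all.2 hyω, eventually_isUnit_gram (S.tendsto_matB hωt)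
      (S.isUnit_gram_matB η hrank5 hG)] with a ha1 ha2 ha3 ha4 ha5
    exact ⟨ha1.1, ha1.2, ha2, fun l => ⟨ha3 l, ha4 l⟩, ha5⟩
  · refine (isLittleO_pi.1 (hy l) i).congr_left fun a => ?_
    rw [paramPert_apply]
    rfl
  · exact S.gain_expansion γ (S.isUnit_gram_matB η hrank5 hG) hu hdO hw hωv l

/-- Multiplying the smoothed matrix by one-sided inverses of `P` and `R` gives an `L × L` matrix
near the identity. This ensures that an output exists. -/
theorem eventually_le_rank (hγ : ∀ l, γ l ≠ 0)
    (hrank5 : (S.J1Freq * S.matP (fun l => S.angFreq (η l))).rank = L)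
    (hG : (S.matG (fun l => S.angFreq (η l))).rank = L) :
    ∀ᶠ d in 𝓝 (0 : S.Idx → ℂ), L ≤ (S.smooth (S.channel η γ + d)).rank := by
  set P := S.matP (fun l => S.angFreq (η l)) with hP
  have hC : pinv (S.J1Freq * P) * S.J1Freq * P = 1 := by
    rw [Matrix.mul_assoc]
    exact pinv_mul_self (isUnit_gram_of_rank (hrank5.trans (Fintype.card_fin L).symm))
  have ht : Tendsto (fun d => pinv (S.J1Freq * P) * S.J1Freq * S.smooth (S.channel η γ + d)
      * S.rightInv η γ) (𝓝 0) (𝓝 1) := by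
    have h0 : Tendsto (fun d => S.smooth (S.channel η γ + d)) (𝓝 0)
        (𝓝 (S.smooth (S.channel η γ))) := by
      have h1 : Continuous fun d => S.smoothL (S.channel η γ + d) :=
        S.smoothL.continuous.comp (continuous_const.add continuous_id)
      simpa [smoothL_apply] using h1.tendsto 0
    have h2 := tendsto_matrix_mul (tendsto_matrix_mul
      (tendsto_const_nhds (x := pinv (S.J1Freq * P) * S.J1Freq)) h0)
      (tendsto_const_nhds (x := S.rightInv η γ))
    rwa [smooth_channel, ← Matrix.mul_assoc, ← hP, hC, Matrix.one_mul,
      S.mul_rightInv η hγ hG] at h2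
  filter_upwards [eventually_isUnit ht isUnit_one] with d hd
  have h1 := Matrix.rank_of_isUnit _ hd
  rw [Fintype.card_fin] at h1
  refine h1.symm.trans_le ?_
  exact (Matrix.rank_mul_le_left _ _).trans (Matrix.rank_mul_le_right _ _)

variable {γ} in
/-- The closed-form perturbations are first-order perturbations of the estimates. -/
theorem isFirstOrderPerturbation (hS : S.ShiftInvariant) (hΔf : 0 < S.Δf) {D : Set (Fin 5 → ℝ)}
    (hD : IsOpen D) (hinj : Set.InjOn S.phasor D) (hη : ∀ l, η l ∈ D) (hγ : ∀ l, γ l ≠ 0)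
    (hT : ∀ l, Real.cos (η l 0) ≠ 0 ∧ Real.sin (η l 1) ≠ 0)
    (hR : ∀ l, Real.cos (η l 2) ≠ 0 ∧ Real.sin (η l 3) ≠ 0)
    (hrank : ∀ n, (S.J1Beam n * S.matP (fun l => S.angFreq (η l))).rank = L)
    (hrank5 : (S.J1Freq * S.matP (fun l => S.angFreq (η l))).rank = L)
    (hG : (S.matG (fun l => S.angFreq (η l))).rank = L) {β : Fin 5 → ℂ}
    (hβ : Function.Injective (fun l : Fin L => ∑ n, β n * S.phasor (η l) n)) :
    S.IsFirstOrderPerturbation D β η γ (S.paramPert η γ) (S.gainPert η γ) := by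
  intro ε hε
  -- The index runs over all pairs of an error and an admissible singular basis, filtered by the
  -- error alone. The little-o terms are then uniform in the basis, as a statement about every
  -- output demands.
  let α := {q : (S.Idx → ℂ) × Matrix S.SIdx (Fin L) ℂ //
    IsLeadingLeftSingular (S.smooth (S.channel η γ + q.1)) q.2}
  let d : α → S.Idx → ℂ := fun q => q.1.1
  obtain ⟨E, ω, y, h1, h2, h3⟩ := S.estimate_expansion η hS hΔf hD hη hγ hT hR hrank hrank5 hG hβ
    (f := comap d (𝓝 0)) (d := d) tendsto_comap (U := fun q => q.1.2) (fun q => q.2)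
  have h2' := eventually_all.2 fun l => eventually_all.2 fun i => (h2 l i).bound hε
  have h3' := eventually_all.2 fun l => (h3 l).bound hε
  obtain ⟨r, hr, hball⟩ := Metric.eventually_nhds_iff.1
    ((eventually_comap.1 (h1.and (h2'.and h3'))).and (S.eventually_le_rank η γ hγ hrank5 hG))
  refine ⟨r, hr, fun e he => ?_⟩
  obtain ⟨hev, hrk⟩ := hball (show dist e 0 < r by rwa [dist_zero_right])
  refine ⟨?_, ?_⟩
  · obtain ⟨U, hU⟩ := exists_isLeadingLeftSingular _ hrk
    obtain ⟨⟨hE, ⟨μ, -, hμ⟩, hexp, hy, -⟩, -⟩ := hev ⟨(e, U), hU⟩ rfl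
    have hEd := (Matrix.isUnit_iff_isUnit_det _).1 hE
    refine ⟨y ⟨(e, U), hU⟩, _, U, E ⟨(e, U), hU⟩, _, hU, hE, ?_, fun l n => rfl, fun l =>
      ⟨(hy l).1, fun n => ?_⟩, rfl⟩
    · rw [Matrix.mul_assoc, hμ, ← Matrix.mul_assoc, Matrix.nonsing_inv_mul _ hEd, Matrix.one_mul]
      exact Matrix.isDiag_diagonal μ
    · rw [phasor, (hy l).2]
      exact hexp l n
  · rintro ηh γh ⟨U, E', ω', hU, hE', hdiag, hω', hηh, rfl⟩
    obtain ⟨⟨hE, ⟨μ, hμi, hμ⟩, hexp, hy, hgr⟩, hb2, hb3⟩ := hev ⟨(e, U), hU⟩ rfl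
    obtain ⟨σ, hσ⟩ := exists_perm_diag_conj hμi hE hμ hE' hdiag
    have hωω : ∀ l n, Complex.exp (Complex.I * (ω' (σ l) n : ℂ))
        = Complex.exp (Complex.I * (ω ⟨(e, U), hU⟩ l n : ℂ)) := fun l n => by
      rw [hω', hσ]
      exact (hexp l n).symm
    -- Both points lie in `D` and have the same phasors, so injectivity on `D` identifies them.
    have hyη : ∀ l, ηh (σ l) = y ⟨(e, U), hU⟩ l := fun l => by
      refine hinj (hηh _).1 (hy l).1 (funext fun n => ?_)
      rw [(hηh _).2, hωω, phasor, (hy l).2]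
    refine ⟨σ, fun l => ⟨fun i => ?_, ?_⟩⟩
    · rw [hyη]
      simpa using hb2 l i
    · have hB : (S.matB (ω ⟨(e, U), hU⟩)).submatrix id σ.symm = S.matB ω' := by
        rw [← matB_perm]
        refine S.matB_congr fun l n => ?_
        rw [← hωω, σ.apply_symm_apply]
      have hγh : (pinv (S.matB ω') *ᵥ (S.channel η γ + e)) (σ l)
          = (pinv (S.matB (ω ⟨(e, U), hU⟩)) *ᵥ (S.channel η γ + e)) l := by
        rw [← hB, pinv_submatrix_perm hgr]
        simp [Matrix.mulVec]
      rw [hγh]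
      simpa using hb3 l

end System

/-! ### Moments of linear functionals of circular complex Gaussian noise -/

section Moments

theorem memLp_id_gaussianReal_two (v : NNReal) : MemLp (fun x : ℝ => x) 2 (gaussianReal 0 v) :=
  memLp_id_gaussianReal 2

/-- Real and imaginary parts are independent, centred and of variance `v / 2`, so the cross term
integrates to zero. -/
theorem circularGaussian_functional {v : ℝ} (hv : 0 ≤ v) (a b : ℝ) :
    MemLp (fun z : ℂ => a * z.re + b * z.im) 2 (circularGaussian v) ∧
      ∫ z, (a * z.re + b * z.im) ∂circularGaussian v = 0 ∧
      ∫ z, (a * z.re + b * z.im) ^ 2 ∂circularGaussian v = v / 2 * (a ^ 2 + b ^ 2) := by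
  set g := gaussianReal 0 (v / 2).toNNReal with hg
  have hmk : Measurable fun p : ℝ × ℝ => (⟨p.1, p.2⟩ : ℂ) :=
    Complex.measurableEquivRealProd.symm.measurable
  have hw : Measurable fun z : ℂ => a * z.re + b * z.im :=
    (Complex.measurable_re.const_mul a).add (Complex.measurable_im.const_mul b)
  have hid : MemLp (fun x : ℝ => x) 2 g := memLp_id_gaussianReal_two _
  have h1 : MemLp (fun p : ℝ × ℝ => a * p.1) 2 (g.prod g) := (hid.comp_fst g).const_mul a
  have h2 : MemLp (fun p : ℝ × ℝ => b * p.2) 2 (g.prod g) := (hid.comp_snd g).const_mul b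
  have hsq : ∫ x, x ^ 2 ∂g = v / 2 := by
    have h := variance_of_integral_eq_zero (X := fun x : ℝ => x) (μ := g) (by fun_prop)
      (by rw [hg, integral_id_gaussianReal])
    rw [hg, variance_fun_id_gaussianReal, Real.coe_toNNReal _ (by positivity)] at h
    exact h.symm
  have hm : ∫ x, x ∂g = 0 := by rw [hg, integral_id_gaussianReal]
  have hi1 := (hid.integrable one_le_two)
  have hi2 := hid.integrable_sq
  have hf1 : ∀ f : ℝ → ℝ, ∫ p : ℝ × ℝ, f p.1 ∂(g.prod g) = ∫ x, f x ∂g := fun f => by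
    have := integral_prod_mul (μ := g) (ν := g) f (fun _ => (1 : ℝ))
    simpa using this
  have hf2 : ∀ f : ℝ → ℝ, ∫ p : ℝ × ℝ, f p.2 ∂(g.prod g) = ∫ x, f x ∂g := fun f => by
    have := integral_prod_mul (μ := g) (ν := g) (fun _ => (1 : ℝ)) f
    simpa using this
  refine ⟨?_, ?_, ?_⟩
  · rw [circularGaussian, memLp_map_measure_iff hw.aestronglyMeasurable hmk.aemeasurable]
    exact h1.add h2
  · rw [circularGaussian, integral_map hmk.aemeasurable hw.aestronglyMeasurable,
      integral_add (h1.integrable one_le_two) (h2.integrable one_le_two), integral_const_mul,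
      integral_const_mul, hf1 fun x => x, hf2 fun x => x, hm]
    simp
  · rw [circularGaussian, integral_map hmk.aemeasurable (hw.pow_const 2).aestronglyMeasurable]
    have e : ∀ p : ℝ × ℝ, (a * p.1 + b * p.2) ^ 2
        = a ^ 2 * p.1 ^ 2 + (2 * a * b) * (p.1 * p.2) + b ^ 2 * p.2 ^ 2 := fun p => by ring
    have i1 : Integrable (fun p : ℝ × ℝ => a ^ 2 * p.1 ^ 2) (g.prod g) :=
      (hi2.comp_fst g).const_mul _
    have i2 : Integrable (fun p : ℝ × ℝ => (2 * a * b) * (p.1 * p.2)) (g.prod g) :=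
      (hi1.mul_prod hi1).const_mul _
    have i3 : Integrable (fun p : ℝ × ℝ => b ^ 2 * p.2 ^ 2) (g.prod g) :=
      (hi2.comp_snd g).const_mul _
    have i12 : Integrable (fun p : ℝ × ℝ => a ^ 2 * p.1 ^ 2 + (2 * a * b) * (p.1 * p.2))
      (g.prod g) := i1.add i2
    simp only [e]
    rw [← hg, integral_add i12 i3, integral_add i1 i2, integral_const_mul, integral_const_mul,
      integral_const_mul, hf1 fun x => x ^ 2, hf2 fun x => x ^ 2, hsq,
      integral_prod_mul (fun x : ℝ => x) (fun x : ℝ => x), hm]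
    ring

variable {Ω ι : Type*} [MeasurableSpace Ω] [Fintype ι] {μ : Measure Ω} [IsProbabilityMeasure μ]
  {X : Ω → ι → ℂ} {v : ℝ}

/-- Moments of a real-linear functional of i.i.d. circular complex Gaussian noise. -/
theorem noise_functional (hv : 0 ≤ v) (hindep : iIndepFun (fun i ω => X ω i) μ)
    (hlaw : ∀ i, HasLaw (fun ω => X ω i) (circularGaussian v) μ) (a b : ι → ℝ) :
    MemLp (fun ω => ∑ i, (a i * (X ω i).re + b i * (X ω i).im)) 2 μ ∧
      ∫ ω, ∑ i, (a i * (X ω i).re + b i * (X ω i).im) ∂μ = 0 ∧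
      ∫ ω, (∑ i, (a i * (X ω i).re + b i * (X ω i).im)) ^ 2 ∂μ
        = v / 2 * ∑ i, (a i ^ 2 + b i ^ 2) := by
  let w : ι → ℂ → ℝ := fun i z => a i * z.re + b i * z.im
  have hw : ∀ i, Measurable (w i) := fun i =>
    (Complex.measurable_re.const_mul (a i)).add (Complex.measurable_im.const_mul (b i))
  have hmem : ∀ i, MemLp (fun ω => w i (X ω i)) 2 μ := fun i => by
    have h := (circularGaussian_functional hv (a i) (b i)).1
    rw [← (hlaw i).map_eq] at h
    exact (memLp_map_measure_iff (hw i).aestronglyMeasurable (hlaw i).aemeasurable).1 h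
  have hmean : ∀ i, ∫ ω, w i (X ω i) ∂μ = 0 := fun i =>
    ((hlaw i).integral_comp (hw i).aestronglyMeasurable).trans
      (circularGaussian_functional hv (a i) (b i)).2.1
  have hsq : ∀ i, ∫ ω, w i (X ω i) ^ 2 ∂μ = v / 2 * (a i ^ 2 + b i ^ 2) := fun i =>
    ((hlaw i).integral_comp ((hw i).pow_const 2).aestronglyMeasurable).trans
      (circularGaussian_functional hv (a i) (b i)).2.2
  have hsum : MemLp (fun ω => ∑ i, w i (X ω i)) 2 μ := memLp_finsetSum _ fun i _ => hmem i
  have hsum0 : ∫ ω, ∑ i, w i (X ω i) ∂μ = 0 := by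
    rw [integral_finsetSum _ fun i _ => (hmem i).integrable one_le_two]
    exact Finset.sum_eq_zero fun i _ => hmean i
  refine ⟨hsum, hsum0, ?_⟩
  have hind := hindep.comp w hw
  have hvar := IndepFun.variance_sum (μ := μ) (s := Finset.univ) (X := fun i ω => w i (X ω i))
    (fun i _ => hmem i) (fun i _ j _ hij => hind.indepFun hij)
  have e1 : (∑ i, fun ω => w i (X ω i)) = fun ω => ∑ i, w i (X ω i) := by
    ext ω
    rw [Finset.sum_apply]
  rw [e1, variance_of_integral_eq_zero hsum.aemeasurable hsum0] at hvar
  rw [Finset.mul_sum]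
  refine hvar.trans (Finset.sum_congr rfl fun i _ => ?_)
  rw [variance_of_integral_eq_zero (hmem i).aemeasurable (hmean i), hsq]

end Moments

namespace System

variable (S : System) {L : ℕ}

/-! ### Uniqueness of the first-order perturbation -/

section Uniqueness

open Filter Topology Asymptotics

/-- A linear map that is `o(‖d‖)` at the origin is its own derivative there, hence zero. -/
theorem eq_of_sub_small {E F : Type*} [NormedAddCommGroup E] [NormedSpace ℝ E]
    [NormedAddCommGroup F] [NormedSpace ℝ F] {f g : E →L[ℝ] F}
    (h : ∀ ε : ℝ, 0 < ε → ∀ᶠ d in 𝓝 (0 : E), ‖f d - g d‖ ≤ ε * ‖d‖) : f = g := by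
  have h1 : HasFDerivAt (fun d => f d - g d) (0 : E →L[ℝ] F) 0 := by
    rw [hasFDerivAt_iff_isLittleO_nhds_zero]
    exact isLittleO_iff.2 fun ε hε => (h ε hε).mono fun d hd => by simpa using hd
  exact sub_eq_zero.1 ((f.hasFDerivAt.sub g.hasFDerivAt).unique h1)

/-- The two expansions could match the same output to the paths by different permutations. For small
`d` the estimates stay near distinct true parameters, so the matchings agree; existence of an output
is essential here. -/
theorem IsFirstOrderPerturbation.unique {D : Set (Fin 5 → ℝ)} {β : Fin 5 → ℂ}
    {η : Fin L → Fin 5 → ℝ} (hη : Function.Injective η) {γ : Fin L → ℂ}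
    {δη δη' : Fin L → Fin 5 → (S.Idx → ℂ) →L[ℝ] ℝ} {δγ δγ' : Fin L → (S.Idx → ℂ) →L[ℝ] ℂ}
    (h : S.IsFirstOrderPerturbation D β η γ δη δγ)
    (h' : S.IsFirstOrderPerturbation D β η γ δη' δγ') : δη = δη' ∧ δγ = δγ' := by
  have key : ∀ ε : ℝ, 0 < ε → ∀ᶠ d in 𝓝 (0 : S.Idx → ℂ), ∀ l,
      (∀ i, ‖δη l i d - δη' l i d‖ ≤ ε * ‖d‖) ∧ ‖δγ l d - δγ' l d‖ ≤ ε * ‖d‖ := by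
    intro ε hε
    obtain ⟨r, hr, H⟩ := h (ε / 2) (half_pos hε)
    obtain ⟨r', hr', H'⟩ := h' (ε / 2) (half_pos hε)
    -- Near zero the combined deviation allowed by both expansions is less than any nonzero
    -- coordinate gap between two paths.
    have hsep : ∀ᶠ d in 𝓝 (0 : S.Idx → ℂ), ∀ k l i, η k i ≠ η l i →
        ε / 2 * ‖d‖ + |δη k i d| + (ε / 2 * ‖d‖ + |δη' l i d|) < |η k i - η l i| := by
      refine eventually_all.2 fun k => eventually_all.2 fun l => eventually_all.2 fun i => ?_
      by_cases hkl : η k i = η l i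
      · exact Eventually.of_forall fun d hd => absurd hkl hd
      have hc : Continuous fun d : S.Idx → ℂ =>
          ε / 2 * ‖d‖ + |δη k i d| + (ε / 2 * ‖d‖ + |δη' l i d|) := by fun_prop
      have := (hc.tendsto 0).eventually_lt_const (u := |η k i - η l i|)
        (by simpa using sub_ne_zero.2 hkl)
      exact this.mono fun d hd _ => hd
    filter_upwards [Metric.ball_mem_nhds _ hr, Metric.ball_mem_nhds _ hr', hsep] with d hd hd' hs
    rw [mem_ball_zero_iff] at hd hd'
    obtain ⟨⟨ηh, γh, hout⟩, Hd⟩ := H d hd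
    obtain ⟨σ, hσ⟩ := Hd ηh γh hout
    obtain ⟨σ', hσ'⟩ := (H' d hd').2 ηh γh hout
    have hσσ : ∀ l, σ l = σ' l := by
      intro l
      obtain ⟨k, hk⟩ := σ'.surjective (σ l)
      have : l = k := by
        refine hη (funext fun i => by_contra fun hne => ?_)
        have h1 := (hσ l).1 i
        have h2 := (hσ' k).1 i
        rw [hk] at h2
        have h3 := hs l k i hne
        have h4 : η l i - η k i = (ηh (σ l) i - η k i - δη' k i d) + δη' k i d
            - ((ηh (σ l) i - η l i - δη l i d) + δη l i d) := by ring
        have h5 := abs_sub ((ηh (σ l) i - η k i - δη' k i d) + δη' k i d)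
          ((ηh (σ l) i - η l i - δη l i d) + δη l i d)
        have h6 := abs_add_le (ηh (σ l) i - η k i - δη' k i d) (δη' k i d)
        have h7 := abs_add_le (ηh (σ l) i - η l i - δη l i d) (δη l i d)
        rw [← h4] at h5
        linarith
      rw [← hk, this]
    intro l
    constructor
    · intro i
      have h1 := (hσ l).1 i
      have h2 := (hσ' l).1 i
      rw [← hσσ] at h2
      have h3 : δη l i d - δη' l i d = (ηh (σ l) i - η l i - δη' l i d)
          - (ηh (σ l) i - η l i - δη l i d) := by ring
      rw [h3]
      refine (norm_sub_le _ _).trans ?_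
      rw [Real.norm_eq_abs, Real.norm_eq_abs]
      linarith
    · have h1 := (hσ l).2
      have h2 := (hσ' l).2
      rw [← hσσ] at h2
      have h3 : δγ l d - δγ' l d = (γh (σ l) - γ l - δγ' l d) - (γh (σ l) - γ l - δγ l d) := by
        ring
      rw [h3]
      refine (norm_sub_le _ _).trans ?_
      linarith
  refine ⟨funext fun l => funext fun i => eq_of_sub_small fun ε hε => ?_,
    funext fun l => eq_of_sub_small fun ε hε => ?_⟩
  · exact (key ε hε).mono fun d hd => (hd l).1 i
  · exact (key ε hε).mono fun d hd => (hd l).2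

end Uniqueness

/-! ### Mean-square values of the first-order perturbation -/

section MeanSquare

variable {Ω : Type*} [MeasurableSpace Ω] {μ : Measure Ω} [IsProbabilityMeasure μ]
  {X : Ω → S.Idx → ℂ} {v : ℝ} (η : Fin L → Fin 5 → ℝ) (γ : Fin L → ℂ) (l : Fin L)

theorem imPairing_eq_sum {ι : Type*} [Fintype ι] (κ d : ι → ℂ) :
    imPairing κ d = ∑ p, (-(κ p).im * (d p).re + (κ p).re * (d p).im) := by
  rw [imPairing_apply, Complex.im_sum]
  refine Finset.sum_congr rfl fun p _ => ?_
  simp [Complex.mul_im]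
  ring

theorem paramPert_moments (hv : 0 ≤ v) (hindep : iIndepFun (fun i ω => X ω i) μ)
    (hlaw : ∀ i, HasLaw (fun ω => X ω i) (circularGaussian v) μ) (i : Fin 5) :
    MemLp (fun ω => S.paramPert η γ l i (X ω)) 2 μ ∧
      ∫ ω, S.paramPert η γ l i (X ω) ∂μ = 0 ∧
      ∫ ω, ‖S.paramPert η γ l i (X ω)‖ ^ 2 ∂μ = v / 2 * sqNorm (S.kappa η γ l i) := by
  obtain ⟨h1, h2, h3⟩ := noise_functional hv hindep hlaw
    (fun p => -(S.kappa η γ l i p).im) (fun p => (S.kappa η γ l i p).re)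
  simp only [← imPairing_eq_sum] at h1 h2 h3
  have hc : (![1, -1, 1, -1, -1] i : ℝ) ^ 2 = 1 := by fin_cases i <;> simp
  have he : ∀ d, S.paramPert η γ l i d
      = ![1, -1, 1, -1, -1] i * imPairing (S.kappa η γ l i) d := fun d => rfl
  simp only [he]
  refine ⟨h1.const_mul _, ?_, ?_⟩
  · rw [integral_const_mul, h2, mul_zero]
  · simp only [Real.norm_eq_abs, sq_abs, mul_pow, hc, one_mul]
    rw [h3, sqNorm]
    congr 1
    refine Finset.sum_congr rfl fun p _ => ?_
    rw [Complex.sq_norm, Complex.normSq_apply]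
    ring

theorem matPi_inl_inl (p : S.Idx) : S.matPi η γ l (Sum.inl ()) (Sum.inl p)
    = (pinv (S.matB fun l => S.angFreq (η l)) l p).re
      - ∑ n, ∑ k, (S.Ups η γ n l k).re * -(S.upsilon η γ k n p).im := by
  simp [matPi, Matrix.sum_apply, Matrix.mul_apply, reM, imM, matV]

theorem matPi_inl_inr (p : S.Idx) : S.matPi η γ l (Sum.inl ()) (Sum.inr p)
    = -(pinv (S.matB fun l => S.angFreq (η l)) l p).im
      - ∑ n, ∑ k, (S.Ups η γ n l k).re * (S.upsilon η γ k n p).re := by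
  simp [matPi, Matrix.sum_apply, Matrix.mul_apply, reM, imM, matV]

theorem matPi_inr_inl (p : S.Idx) : S.matPi η γ l (Sum.inr ()) (Sum.inl p)
    = (pinv (S.matB fun l => S.angFreq (η l)) l p).im
      - ∑ n, ∑ k, (S.Ups η γ n l k).im * -(S.upsilon η γ k n p).im := by
  simp [matPi, Matrix.sum_apply, Matrix.mul_apply, reM, imM, matV]

theorem matPi_inr_inr (p : S.Idx) : S.matPi η γ l (Sum.inr ()) (Sum.inr p)
    = (pinv (S.matB fun l => S.angFreq (η l)) l p).re
      - ∑ n, ∑ k, (S.Ups η γ n l k).im * (S.upsilon η γ k n p).re := by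
  simp [matPi, Matrix.sum_apply, Matrix.mul_apply, reM, imM, matV]

theorem sum_mul_imPairing_upsilon (c : Fin 5 → Fin L → ℝ) (d : S.Idx → ℂ) :
    ∑ n, ∑ k, c n k * imPairing (S.upsilon η γ k n) d
      = ∑ p, ((∑ n, ∑ k, c n k * -(S.upsilon η γ k n p).im) * (d p).re
        + (∑ n, ∑ k, c n k * (S.upsilon η γ k n p).re) * (d p).im) := by
  simp only [imPairing_eq_sum, Finset.mul_sum, Finset.sum_mul, ← Finset.sum_add_distrib]
  refine Eq.trans (Finset.sum_congr rfl fun n _ => Finset.sum_comm) ?_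
  refine Finset.sum_comm.trans (Finset.sum_congr rfl fun p _ => Finset.sum_congr rfl fun n _ =>
    Finset.sum_congr rfl fun k _ => ?_)
  ring

/-- The rows of `Π_l` are the coefficients of the real and imaginary gain errors with respect to
`(Re d, Im d)`; adding their second moments gives the Frobenius norm. -/
theorem gainPert_re_im (d : S.Idx → ℂ) :
    (S.gainPert η γ l d).re = ∑ p, (S.matPi η γ l (Sum.inl ()) (Sum.inl p) * (d p).re
        + S.matPi η γ l (Sum.inl ()) (Sum.inr p) * (d p).im) ∧
    (S.gainPert η γ l d).im = ∑ p, (S.matPi η γ l (Sum.inr ()) (Sum.inl p) * (d p).re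
        + S.matPi η γ l (Sum.inr ()) (Sum.inr p) * (d p).im) := by
  simp only [gainPert_apply, Complex.sub_re, Complex.sub_im, Complex.re_sum, Complex.im_sum,
    Complex.re_mul_ofReal, Complex.im_mul_ofReal, matPi_inl_inl, matPi_inl_inr, matPi_inr_inl,
    matPi_inr_inr]
  rw [S.sum_mul_imPairing_upsilon η γ fun n k => (S.Ups η γ n l k).re,
    S.sum_mul_imPairing_upsilon η γ fun n k => (S.Ups η γ n l k).im,
    ← Finset.sum_sub_distrib, ← Finset.sum_sub_distrib]
  constructor <;> refine Finset.sum_congr rfl fun p _ => ?_ <;>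
    simp only [Complex.mul_re, Complex.mul_im] <;> ring

theorem gainPert_moments (hv : 0 ≤ v) (hindep : iIndepFun (fun i ω => X ω i) μ)
    (hlaw : ∀ i, HasLaw (fun ω => X ω i) (circularGaussian v) μ) :
    MemLp (fun ω => S.gainPert η γ l (X ω)) 2 μ ∧
      ∫ ω, S.gainPert η γ l (X ω) ∂μ = 0 ∧
      ∫ ω, ‖S.gainPert η γ l (X ω)‖ ^ 2 ∂μ = v / 2 * frobSq (S.matPi η γ l) := by
  obtain ⟨h1, h2, h3⟩ := noise_functional hv hindep hlaw
    (fun p => S.matPi η γ l (Sum.inl ()) (Sum.inl p))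
    (fun p => S.matPi η γ l (Sum.inl ()) (Sum.inr p))
  obtain ⟨h4, h5, h6⟩ := noise_functional hv hindep hlaw
    (fun p => S.matPi η γ l (Sum.inr ()) (Sum.inl p))
    (fun p => S.matPi η γ l (Sum.inr ()) (Sum.inr p))
  simp only [← (S.gainPert_re_im η γ l _).1] at h1 h2 h3
  simp only [← (S.gainPert_re_im η γ l _).2] at h4 h5 h6
  have hmem : MemLp (fun ω => S.gainPert η γ l (X ω)) 2 μ := memLp_re_im_iff.1 ⟨h1, h4⟩
  refine ⟨hmem, ?_, ?_⟩
  · have hre := integral_re (hmem.integrable one_le_two)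
    have him := integral_im (hmem.integrable one_le_two)
    refine Complex.ext ?_ ?_
    · exact hre.symm.trans h2
    · exact him.symm.trans h5
  · have e : ∀ z : ℂ, ‖z‖ ^ 2 = z.re ^ 2 + z.im ^ 2 := fun z => by
      rw [Complex.sq_norm, Complex.normSq_apply]; ring
    simp only [e]
    rw [integral_add h1.integrable_sq h4.integrable_sq, h3, h6, ← mul_add, frobSq]
    congr 1
    simp [Fintype.sum_sum_type, Finset.sum_add_distrib]
    ring

end MeanSquare

end System

end BeamspaceESPRIT

end

/-! ### The mean-square error formulas -/

theorem proposition4 (S : BeamspaceESPRIT.System) (L : ℕ) (hS : S.ShiftInvariant)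
    (hΔf : 0 < S.Δf)
    -- the parameter domain, on which the angular frequencies determine the parameters
    (D : Set (Fin 5 → ℝ)) (hD : IsOpen D) (hinj : Set.InjOn S.phasor D)
    -- the paths
    (η : Fin L → Fin 5 → ℝ) (γ : Fin L → ℂ) (hη : ∀ l, η l ∈ D) (hγ : ∀ l, γ l ≠ 0)
    (hT : ∀ l, Real.cos (η l 0) ≠ 0 ∧ Real.sin (η l 1) ≠ 0)
    (hR : ∀ l, Real.cos (η l 2) ≠ 0 ∧ Real.sin (η l 3) ≠ 0)
    -- identifiability: full column rank, and distinct eigenvalues of `K`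
    (hrank : ∀ n, (S.J1Beam n * S.matP (fun l => S.angFreq (η l))).rank = L)
    (hrank5 : (S.J1Freq * S.matP (fun l => S.angFreq (η l))).rank = L)
    (hG : (S.matG (fun l => S.angFreq (η l))).rank = L)
    (β : Fin 5 → ℂ)
    (hβ : Function.Injective (fun l : Fin L => ∑ n, β n * S.phasor (η l) n))
    -- the channel estimation error
    (N₀ Es : ℝ) (Np : ℕ) (hN₀ : 0 < N₀) (hEs : 0 < Es) (hNp : 0 < Np)
    {Ω : Type*} [MeasurableSpace Ω] (μ : MeasureTheory.Measure Ω)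
    [MeasureTheory.IsProbabilityMeasure μ] (Δh : Ω → S.Idx → ℂ)
    (hindep : ProbabilityTheory.iIndepFun (fun i ω => Δh ω i) μ)
    (hlaw : ∀ i, ProbabilityTheory.HasLaw (fun ω => Δh ω i)
      (BeamspaceESPRIT.circularGaussian (N₀ / (Np * Es))) μ) :
    (∃ (δη : Fin L → Fin 5 → (S.Idx → ℂ) →L[ℝ] ℝ) (δγ : Fin L → (S.Idx → ℂ) →L[ℝ] ℂ),
      S.IsFirstOrderPerturbation D β η γ δη δγ) ∧
    ∀ (δη : Fin L → Fin 5 → (S.Idx → ℂ) →L[ℝ] ℝ) (δγ : Fin L → (S.Idx → ℂ) →L[ℝ] ℂ),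
      S.IsFirstOrderPerturbation D β η γ δη δγ →
      ∀ l,
        (∀ i, MeasureTheory.MemLp (fun ω => δη l i (Δh ω)) 2 μ ∧
          ∫ ω, δη l i (Δh ω) ∂μ = 0 ∧
          ∫ ω, ‖δη l i (Δh ω)‖ ^ 2 ∂μ
            = N₀ * BeamspaceESPRIT.sqNorm (S.kappa η γ l i) / (2 * Np * Es)) ∧
        MeasureTheory.MemLp (fun ω => δγ l (Δh ω)) 2 μ ∧
        ∫ ω, δγ l (Δh ω) ∂μ = 0 ∧
        ∫ ω, ‖δγ l (Δh ω)‖ ^ 2 ∂μ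
          = N₀ * BeamspaceESPRIT.frobSq (S.matPi η γ l) / (2 * Np * Es) := by
  -- Distinct eigenvalues force distinct paths, which uniqueness of the perturbation needs.
  have hηinj : Function.Injective η := fun l l' h => hβ (by simp only [h])
  have hv : 0 ≤ N₀ / (Np * Es) := by positivity
  have hNp' : (Np : ℝ) ≠ 0 := Nat.cast_ne_zero.2 hNp.ne'
  have hval : ∀ x : ℝ, N₀ / (Np * Es) / 2 * x = N₀ * x / (2 * Np * Es) := fun x => by
    field_simp
  have hfirst := S.isFirstOrderPerturbation η hS hΔf hD hinj hη hγ hT hR hrank hrank5 hG hβ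
  refine ⟨⟨_, _, hfirst⟩, fun δη δγ h l => ?_⟩
  obtain ⟨rfl, rfl⟩ :=
    BeamspaceESPRIT.System.IsFirstOrderPerturbation.unique S hηinj h hfirst
  refine ⟨fun i => ?_, ?_⟩
  · rw [← hval]
    exact S.paramPert_moments η γ l hv hindep hlaw i
  · rw [← hval]
    exact S.gainPert_moments η γ l hv hindep hlaw
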